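/- Work with symmetric functions over $\mathbb{Q}$ in the variables $x=(x_1,x_2,\dots)$. For a symmetric function $f$, let $f(x/x)$ be its shiftification: write $f$ as a polynomial in the power sums $p_k$ and substitute $p_k\to 2p_k$ for $k$ odd and $p_k\to 0$ for $k$ even. Let $f(1^{N})$ be the value of $f$ at $x_1=\cdots=x_{N}=1$, $x_i=0$ for $i>N$. A parking function of length $n$ is a sequence of $n$ positive integers whose increasing rearrangement $b_1\le\cdots\le b_n$ satisfies $b_i\le i$ for all $i$. Let $\mathrm{PF}_n$ be the Frobenius characteristic of the action of the symmetric group $\mathfrak{S}_n$ on the parking functions of length $n$ by permuting coordinates, and let $\mathrm{SH}_n(x)=\mathrm{PF}_n(x/x)$. For a partition $\lambda$ with distinct parts, let $P_\lambda$ be Schur's $P$-function, and let $P_n=P_{(n)}$, so that $1+2\sum_{n\ge1}P_n(x)t^n=\prod_i\frac{1+x_it}{1-x_it}$. Let $r_n$ be the large Schröder numbers, given by $r_0=1$ and $r_{n}=r_{n-1}+\sum_{i=0}^{n-1}r_ir_{n-1-i}$ for $n\ge1$ (so $r_1=2$, $r_2=6$, $r_3=22$). Then for every $n\ge1$ each of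 the following numbers is equal to $r_n$: 1. $\frac{2}{n+1}P_n(1^{n+1})$; 2. the coefficient of $P_n$ when $\mathrm{SH}_n$ is written as a linear combination of the $P_\lambda$, where $\lambda$ ranges over the partitions of $n$ into distinct parts (such an expression exists, and the coefficient of $P_n$ does not depend on it); 3. the sum of the coefficients of $\mathrm{SH}_n$ when it is written as a polynomial in $P_1,P_3,P_5,\dots$ (such an expression exists, and the sum of its coefficients does not depend on it). -/

import Mathlib

namespace ShiftedParking

noncomputable section

/-! ### Symmetric functions in the variables `x₀, x₁, x₂, …`, as formal power series over `ℚ` -/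

/-- The complete homogeneous symmetric function `h_n`: the sum of all monomials of degree `n`. -/
def hsymm (n : ℕ) : MvPowerSeries ℕ ℚ :=
  fun d => if d.degree = n then 1 else 0

open Classical in
/-- The elementary symmetric function `e_n`: the sum of all squarefree monomials of degree `n`. -/
def esymm (n : ℕ) : MvPowerSeries ℕ ℚ :=
  fun d => if d.degree = n ∧ ∀ i, d i ≤ 1 then 1 else 0

open Classical in
/-- The power sum `p_k = ∑ i, x_i ^ k`, for `k ≥ 1`. -/
def psum (k : ℕ) : MvPowerSeries ℕ ℚ :=
  fun d => if ∃ i : ℕ, d = Finsupp.single i k then 1 else 0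

/-- The value `f(x)` of a symmetric function `f` (a power series of bounded degree)
at a point `x = (x₀, x₁, …)` with finitely many nonzero coordinates. For such `f` and `x` only
finitely many terms of the sum are nonzero. -/
def specialize (x : ℕ → ℚ) (f : MvPowerSeries ℕ ℚ) : ℚ :=
  ∑ᶠ d : ℕ →₀ ℕ, MvPowerSeries.coeff d f * d.prod fun i k => x i ^ k

/-- The point `1^N = (1, …, 1, 0, 0, …)` with `N` ones. -/
def ones (N : ℕ) : ℕ → ℚ := fun i => if i < N then 1 else 0

/-! ### Schur's `P`-functions -/

/-- `q_n = h_n(x/x) = ∑ k, e_k h_{n-k}`, so that `∑ q_n t^n = ∏ (1 + x_i t) / (1 - x_i t)`. -/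
def q (n : ℕ) : MvPowerSeries ℕ ℚ :=
  ∑ k ∈ Finset.range (n + 1), esymm k * hsymm (n - k)

/-- `Q_{(r,s)} = q_r q_s + 2 ∑_{i=1}^{s} (-1)^i q_{r+i} q_{s-i}`, for `r > s ≥ 0`. -/
def qTwo (r s : ℕ) : MvPowerSeries ℕ ℚ :=
  q r * q s + 2 * ∑ i ∈ Finset.Icc 1 s, (-1) ^ i * (q (r + i) * q (s - i))

/-- The Pfaffian of a skew-symmetric matrix of size `2m`, by expansion along the first row. -/
def pfaffian {R : Type*} [CommRing R] :
    (m : ℕ) → Matrix (Fin (2 * m)) (Fin (2 * m)) R → R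
  | 0, _ => 1
  | m + 1, A =>
    ∑ j : Fin (2 * m + 1), (-1) ^ (j : ℕ) * A (0 : Fin (2 * m + 2)) j.succ *
      pfaffian m (A.submatrix (fun k : Fin (2 * m) => (j.succAbove k).succ)
        (fun k : Fin (2 * m) => (j.succAbove k).succ))

/-- The `i`-th part (counted from `0`) of a partition, its parts being listed in weakly
decreasing order and followed by zeros. -/
def part {n : ℕ} (μ : n.Partition) (i : ℕ) : ℕ :=
  (μ.parts.sort (· ≥ ·)).getD i 0

/-- The skew-symmetric matrix with entries `Q_{(μ_i, μ_j)}` for `i < j`. -/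
def qMatrix {n : ℕ} (μ : n.Partition) (m : ℕ) :
    Matrix (Fin (2 * m)) (Fin (2 * m)) (MvPowerSeries ℕ ℚ) :=
  fun i j =>
    if i < j then qTwo (part μ i) (part μ j)
    else if j < i then -qTwo (part μ j) (part μ i)
    else 0

/-- Schur's `Q`-function of a partition `μ` into distinct parts, by Schur's definition: the
Pfaffian of the matrix `(Q_{(μ_i, μ_j)})` of size `2m`, where `2m` is the length `ℓ` of `μ` if
`ℓ` is even, and `ℓ + 1` (with a last part `0` added to `μ`) if `ℓ` is odd. -/
def schurQ {n : ℕ} (μ : n.Partition) : MvPowerSeries ℕ ℚ :=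
  pfaffian ((μ.parts.card + 1) / 2) (qMatrix μ ((μ.parts.card + 1) / 2))

/-- Schur's `P`-function `P_μ = 2^{-ℓ(μ)} Q_μ` of a partition `μ` into distinct parts. -/
def schurP {n : ℕ} (μ : n.Partition) : MvPowerSeries ℕ ℚ :=
  ((2 : ℚ) ^ μ.parts.card)⁻¹ • schurQ μ

/-- `P_n`, Schur's `P`-function of the partition `(n)`, for `n ≥ 1`. -/
def schurPRow (n : ℕ) : MvPowerSeries ℕ ℚ := schurP (Nat.Partition.indiscrete n)

/-! ### The (shifted) parking function symmetric function

Symmetric functions over `ℚ` are the polynomials in the power sums. In `MvPolynomial ℕ ℚ` the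
variable `X k` with `k ≥ 1` stands for `p_k` (the variable `X 0` is not used). -/

/-- The symmetric function given by a polynomial in the power sums. -/
def ofPowerSums : MvPolynomial ℕ ℚ →ₐ[ℚ] MvPowerSeries ℕ ℚ := MvPolynomial.aeval psum

/-- Shiftification `f ↦ f(x/x)`: the substitution `p_k → 2 p_k` for odd `k`, and `p_k → 0` for
even `k`. -/
def shiftify : MvPolynomial ℕ ℚ →ₐ[ℚ] MvPolynomial ℕ ℚ :=
  MvPolynomial.aeval fun k => if Odd k then 2 * MvPolynomial.X k else 0

/-- A parking function of length `n`: a sequence of `n` positive integers whose increasing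
rearrangement `b_1 ≤ ⋯ ≤ b_n` satisfies `b_i ≤ i`. -/
def IsParkingFunction {n : ℕ} (a : Fin n → ℕ) : Prop :=
  (∀ i, 1 ≤ a i) ∧ ∀ i, a (Tuple.sort a i) ≤ (i : ℕ) + 1

/-- The character, at the permutation `w`, of the action of the symmetric group on the parking
functions of length `n` by permuting coordinates: the number of parking functions fixed
by `w`. -/
def parkingCharacter {n : ℕ} (w : Equiv.Perm (Fin n)) : ℕ :=
  {a : Fin n → ℕ | IsParkingFunction a ∧ ∀ i, a (w⁻¹ i) = a i}.ncard

/-- The Frobenius characteristic `(1/n!) ∑_w χ(w) p_{ρ(w)}` of a class function `χ` on the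
symmetric group, as a polynomial in the power sums. Here `ρ(w)` is the cycle type of `w`,
fixed points included. -/
def frobeniusCharacteristic {n : ℕ} (χ : Equiv.Perm (Fin n) → ℚ) : MvPolynomial ℕ ℚ :=
  ((n.factorial : ℚ))⁻¹ •
    ∑ w : Equiv.Perm (Fin n), χ w • (w.partition.parts.map MvPolynomial.X).prod

/-- The parking function symmetric function `PF_n`, as a polynomial in the power sums. -/
def parkingSymm (n : ℕ) : MvPolynomial ℕ ℚ :=
  frobeniusCharacteristic fun w : Equiv.Perm (Fin n) => (parkingCharacter w : ℚ)

/-- The shifted parking function symmetric function `SH_n = PF_n(x/x)`. -/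
def shiftedParkingSymm (n : ℕ) : MvPowerSeries ℕ ℚ :=
  ofPowerSums (shiftify (parkingSymm n))

/-- The sum of the coefficients of a polynomial. -/
def coeffSum {σ : Type*} (F : MvPolynomial σ ℚ) : ℚ := ∑ d ∈ F.support, F.coeff d

end

end ShiftedParking

namespace ShiftedParking

open PowerSeries

/-! ### Power series with a prescribed logarithmic derivative -/

section LogDeriv

variable {R S : Type*} [CommRing R] [CommRing S]

/-- `A` has constant term `1` and satisfies `t A' = C A`; over a `ℚ`-algebra this determines `A`. -/
def HasLogDeriv (C A : R⟦X⟧) : Prop :=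
  constantCoeff A = 1 ∧ X * d⁄dX R A = C * A

theorem coeff_X_mul_derivative (A : R⟦X⟧) (n : ℕ) :
    coeff n (X * d⁄dX R A) = n * coeff n A := by
  cases n with
  | zero => simp
  | succ n => rw [coeff_succ_X_mul, coeff_derivative, mul_comm]; push_cast; rfl

theorem hasLogDeriv_iff {C A : R⟦X⟧} : HasLogDeriv C A ↔ coeff 0 A = 1 ∧
    ∀ n : ℕ, (n : R) * coeff n A =
      ∑ x ∈ Finset.HasAntidiagonal.antidiagonal n, coeff x.1 C * coeff x.2 A := by
  simp only [HasLogDeriv, PowerSeries.ext_iff, coeff_X_mul_derivative,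
    coeff_zero_eq_constantCoeff_apply]
  simp only [coeff_mul]

theorem HasLogDeriv.constantCoeff_eq_zero {C A : R⟦X⟧} (h : HasLogDeriv C A) :
    constantCoeff C = 0 := by
  have := congrArg constantCoeff h.2
  simpa [h.1] using this.symm

theorem HasLogDeriv.unique [Algebra ℚ R] {C A B : R⟦X⟧} (hA : HasLogDeriv C A)
    (hB : HasLogDeriv C B) : A = B := by
  have hC := hA.constantCoeff_eq_zero
  rw [hasLogDeriv_iff] at hA hB
  ext n
  induction n using Nat.strong_induction_on with
  | _ n ih =>
    rcases Nat.eq_zero_or_pos n with rfl | hn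
    · rw [hA.1, hB.1]
    · have : (n : R) * coeff n A = n * coeff n B := by
        rw [hA.2, hB.2]
        refine Finset.sum_congr rfl fun x hx => ?_
        rw [Finset.HasAntidiagonal.mem_antidiagonal] at hx
        rcases Nat.eq_zero_or_pos x.1 with h0 | h0
        · simp [h0, hC]
        · rw [ih x.2 (by omega)]
      have hu : IsUnit (n : R) := by
        have : IsUnit (n : ℚ) := by simp; omega
        simpa using this.map (algebraMap ℚ R)
      exact hu.mul_left_cancel this

theorem HasLogDeriv.one : HasLogDeriv (0 : R⟦X⟧) 1 := by
  simp [HasLogDeriv]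

theorem HasLogDeriv.mul {C D A B : R⟦X⟧} (hA : HasLogDeriv C A) (hB : HasLogDeriv D B) :
    HasLogDeriv (C + D) (A * B) := by
  refine ⟨by simp [hA.1, hB.1], ?_⟩
  rw [Derivation.leibniz]
  simp only [smul_eq_mul]
  linear_combination B * hA.2 + A * hB.2

theorem HasLogDeriv.pow {C A : R⟦X⟧} (hA : HasLogDeriv C A) (n : ℕ) :
    HasLogDeriv ((n : R⟦X⟧) * C) (A ^ n) := by
  induction n with
  | zero => simpa using HasLogDeriv.one
  | succ n ih =>
    have := ih.mul hA
    rw [pow_succ]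
    convert this using 1
    push_cast; ring

theorem HasLogDeriv.map {C A : R⟦X⟧} (hA : HasLogDeriv C A) (f : R →+* S) :
    HasLogDeriv (PowerSeries.map f C) (PowerSeries.map f A) := by
  rw [hasLogDeriv_iff] at *
  refine ⟨by simp only [coeff_map, hA.1, map_one], fun n => ?_⟩
  simp only [coeff_map, ← map_mul, ← map_sum, ← hA.2]
  simp

theorem HasLogDeriv.rescale {C A : R⟦X⟧} (hA : HasLogDeriv C A) (a : R) :
    HasLogDeriv (PowerSeries.rescale a C) (PowerSeries.rescale a A) := by
  refine ⟨by rw [← coeff_zero_eq_constantCoeff_apply, coeff_rescale]; simpa using hA.1, ?_⟩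
  rw [← map_mul, ← hA.2]
  ext n
  rw [coeff_X_mul_derivative, coeff_rescale, coeff_rescale, coeff_X_mul_derivative]
  ring

end LogDeriv

/-! ### The large Schröder numbers by Lagrange inversion -/

/-- The power series `(1 + t) / (1 - t)`. -/
noncomputable def mobius : ℚ⟦X⟧ := (1 + X) * (1 - X)⁻¹

/-- The generating series of the large Schröder numbers. -/
noncomputable def schroderSeries : ℚ⟦X⟧ := mk fun n => (Nat.largeSchroder n : ℚ)

theorem one_sub_X_mul_mobius : (1 - X) * mobius = 1 + X := by
  rw [mobius, mul_left_comm, PowerSeries.mul_inv_cancel _ (by simp), mul_one]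

theorem constantCoeff_mobius : constantCoeff mobius = 1 := by
  simpa using congrArg constantCoeff one_sub_X_mul_mobius

theorem mobius_sub_one : mobius - 1 = X * (1 + mobius) := by
  linear_combination one_sub_X_mul_mobius

theorem one_sub_X_mul_derivative_mobius : (1 - X) * d⁄dX ℚ mobius = 1 + mobius := by
  have := congrArg (d⁄dX ℚ) one_sub_X_mul_mobius
  rw [Derivation.leibniz, map_sub, map_add, derivative_one, derivative_X] at this
  simp only [smul_eq_mul] at this
  linear_combination this

/-- The series `2t + 2t³ + 2t⁵ + ⋯`. -/
noncomputable def oddSeries : ℚ⟦X⟧ := mk fun k => if Odd k then 2 else 0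

theorem one_sub_X_sq_mul_oddSeries : (1 - X ^ 2) * oddSeries = 2 * X := by
  ext n
  have h2 : (2 : ℚ⟦X⟧) = C 2 := (map_ofNat C 2).symm
  rw [sub_mul, one_mul, map_sub, coeff_X_pow_mul', h2, coeff_C_mul, coeff_X, oddSeries, coeff_mk,
    coeff_mk]
  rcases n with _ | _ | n
  · simp
  · simp
  · have : Odd (n + 1 + 1) ↔ Odd n := by simp [Nat.odd_add_one]
    simp [this]

theorem hasLogDeriv_mobius : HasLogDeriv oddSeries mobius := by
  refine ⟨constantCoeff_mobius, ?_⟩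
  have h1 : (1 - X : ℚ⟦X⟧) ≠ 0 := fun h => by simpa using congrArg constantCoeff h
  have h2 : (1 + X : ℚ⟦X⟧) ≠ 0 := fun h => by simpa using congrArg constantCoeff h
  refine mul_left_cancel₀ h1 (mul_left_cancel₀ h1 (mul_left_cancel₀ h2 ?_))
  linear_combination (1 - X) * (1 + X) * X * one_sub_X_mul_derivative_mobius
    - (1 - X) * mobius * one_sub_X_sq_mul_oddSeries + ((1+X) * X - 2 * X) * one_sub_X_mul_mobius

theorem mobius_pow_derivative_sub (N : ℕ) :
    (1 - X) * (X * d⁄dX ℚ (mobius ^ (N + 1))) =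
      ((N : ℚ) + 1) • (mobius ^ (N + 1) - mobius ^ N) := by
  rw [derivative_pow, Algebra.smul_def]
  simp only [add_tsub_cancel_right, map_add, map_natCast, map_one]
  push_cast
  linear_combination (N + 1 : ℚ⟦X⟧) * mobius ^ N * X * one_sub_X_mul_derivative_mobius
    - (N + 1 : ℚ⟦X⟧) * mobius ^ N * mobius_sub_one

theorem mobius_pow_derivative_add (N : ℕ) :
    (1 + X) * (X * d⁄dX ℚ (mobius ^ N)) =
      (N : ℚ) • (mobius ^ (N + 1) - mobius ^ N) := by
  cases N with
  | zero => simp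
  | succ N =>
    have := mobius_pow_derivative_sub N
    rw [← one_sub_X_mul_mobius, mul_right_comm, this, Algebra.smul_def, Algebra.smul_def]
    push_cast
    ring

theorem coeff_one_sub_X_mul (A : ℚ⟦X⟧) (m : ℕ) :
    coeff (m + 1) ((1 - X) * A) = coeff (m + 1) A - coeff m A := by
  rw [sub_mul, one_mul, map_sub, coeff_succ_X_mul]

theorem coeff_one_add_X_mul (A : ℚ⟦X⟧) (m : ℕ) :
    coeff (m + 1) ((1 + X) * A) = coeff (m + 1) A + coeff m A := by
  rw [add_mul, one_mul, map_add, coeff_succ_X_mul]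

theorem schroderSeries_eq :
    schroderSeries = 1 + X * schroderSeries + X * schroderSeries ^ 2 := by
  ext n
  cases n with
  | zero => simp [schroderSeries]
  | succ n =>
    rw [map_add, map_add, coeff_succ_X_mul, coeff_succ_X_mul, pow_two, coeff_mul,
      Finset.Nat.sum_antidiagonal_eq_sum_range_succ_mk]
    simp [schroderSeries, Nat.largeSchroder_succ, coeff_one, Nat.range_succ_eq_Iic]

theorem coeff_schroderSeries_pow (m k : ℕ) :
    ((m : ℚ) + k) * coeff m (schroderSeries ^ k) = k * coeff m (mobius ^ (m + k)) := by
  induction m generalizing k with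
  | zero => simp [schroderSeries, constantCoeff_mobius]
  | succ m ihm =>
    induction k with
    | zero => simp [coeff_one]
    | succ k ihk =>
      have hR : coeff (m + 1) (schroderSeries ^ (k + 1)) = coeff (m + 1) (schroderSeries ^ k) +
          coeff m (schroderSeries ^ (k + 1)) + coeff m (schroderSeries ^ (k + 2)) := by
        rw [← coeff_succ_X_mul m, ← coeff_succ_X_mul m, ← map_add, ← map_add]
        congr 1
        linear_combination schroderSeries ^ k * schroderSeries_eq
      have h1 := congrArg (coeff (m + 1)) (mobius_pow_derivative_sub (m + k + 1))
      have h2 := congrArg (coeff (m + 1)) (mobius_pow_derivative_add (m + k + 1))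
      have h3 := congrArg (fun s => coeff (m + 1) (s * mobius ^ (m + k + 1))) one_sub_X_mul_mobius
      simp only [coeff_one_sub_X_mul, coeff_one_add_X_mul, coeff_X_mul_derivative, mul_assoc,
        ← pow_succ', coeff_smul, map_sub, smul_eq_mul] at h1 h2 h3
      have e1 := ihm (k + 1)
      have e2 := ihm (k + 2)
      rw [show m + 1 + k = m + k + 1 by ring] at ihk
      rw [show m + 1 + (k + 1) = m + k + 1 + 1 by ring]
      rw [show m + (k + 1) = m + k + 1 by ring] at e1
      rw [show m + (k + 2) = m + k + 1 + 1 by ring] at e2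
      have hN : ((m : ℚ) + k + 1) ≠ 0 := by positivity
      refine mul_left_cancel₀ hN ?_
      push_cast at *
      generalize coeff (m + 1) (mobius ^ (m + k + 1 + 1)) = a at *
      generalize coeff (m + 1) (mobius ^ (m + k + 1)) = b at *
      generalize coeff m (mobius ^ (m + k + 1 + 1)) = c at *
      generalize coeff m (mobius ^ (m + k + 1)) = d at *
      rw [hR]
      linear_combination (m + k + 2 : ℚ) * ihk + (m + k + 2 : ℚ) * e1 + (m + k + 1 : ℚ) * e2
        + (m + k + 1 : ℚ) * h1 - (m + k + 2 : ℚ) * h2 - (m + k + 1 : ℚ) * (m + k + 2) * h3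

theorem coeff_mobius_pow_succ (n : ℕ) :
    coeff n (mobius ^ (n + 1)) = ((n : ℚ) + 1) * Nat.largeSchroder n := by
  have := coeff_schroderSeries_pow n 1
  simpa [schroderSeries] using this.symm

/-! ### The cycle index of the symmetric group -/

section CycleIndex

open scoped Nat
open Equiv

/-- The order `z` of the centralizer of a permutation of cycle type `s`, fixed points included. -/
def centralizerCard (s : Multiset ℕ) : ℕ := s.prod * ∏ k ∈ s.toFinset, (s.count k)!

theorem centralizerCard_cons (k : ℕ) (s : Multiset ℕ) :
    centralizerCard (k ::ₘ s) = k * (s.count k + 1) * centralizerCard s := by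
  have h : ∀ t : Multiset ℕ, t.toFinset ⊆ (k ::ₘ s).toFinset →
      ∏ i ∈ t.toFinset, (t.count i)! = ∏ i ∈ (k ::ₘ s).toFinset, (t.count i)! := by
    intro t ht
    refine Finset.prod_subset ht fun x _ hx => ?_
    rw [Multiset.count_eq_zero_of_notMem (by simpa using hx), Nat.factorial_zero]
  have hk : k ∈ (k ::ₘ s).toFinset := by simp
  rw [centralizerCard, centralizerCard, h s (by simp), Multiset.prod_cons,
    ← Finset.mul_prod_erase _ _ hk, ← Finset.mul_prod_erase _ _ hk, Multiset.count_cons_self,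
    Nat.factorial_succ,
    Finset.prod_congr rfl fun i hi => by
      rw [Multiset.count_cons_of_ne (Finset.ne_of_mem_erase hi)]]
  ring

theorem centralizerCard_add_replicate_one (s : Multiset ℕ) (hs : 1 ∉ s) (r : ℕ) :
    centralizerCard (s + Multiset.replicate r 1) = r ! * centralizerCard s := by
  induction r with
  | zero => simp
  | succ r ih =>
    rw [Multiset.replicate_succ, Multiset.add_cons, centralizerCard_cons, ih, Multiset.count_add,
      Multiset.count_eq_zero_of_notMem hs, Multiset.count_replicate_self, Nat.factorial_succ]
    ring

theorem centralizerCard_pos {s : Multiset ℕ} (hs : 0 ∉ s) : 0 < centralizerCard s :=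
  Nat.mul_pos (Multiset.prod_pos fun _ ha => Nat.pos_of_ne_zero fun h => hs (h ▸ ha))
    (Finset.prod_pos fun _ _ => Nat.factorial_pos _)

theorem _root_.Nat.Partition.parts_eq_filter_add_replicate {n : ℕ} (μ : n.Partition) :
    μ.parts = μ.parts.filter (2 ≤ ·) +
      Multiset.replicate (n - (μ.parts.filter (2 ≤ ·)).sum) 1 := by
  have h : μ.parts.filter (¬ 2 ≤ ·) = Multiset.replicate (μ.parts.filter (¬ 2 ≤ ·)).card 1 := by
    rw [Multiset.eq_replicate_card]
    intro b hb
    rw [Multiset.mem_filter] at hb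
    have := μ.parts_pos hb.1
    omega
  have h1 := Multiset.filter_add_not (2 ≤ ·) μ.parts
  have h2 := congrArg Multiset.sum h1
  rw [h, Multiset.sum_add, μ.parts_sum, Multiset.sum_replicate] at h2
  have h3 : n - (μ.parts.filter (2 ≤ ·)).sum = (μ.parts.filter (¬ 2 ≤ ·)).card := by
    rw [smul_eq_mul, mul_one] at h2
    omega
  rw [h3, ← h, h1]

variable {α : Type*} [Fintype α] [DecidableEq α]

theorem partition_eq_iff (w : Perm α) (μ : (Fintype.card α).Partition) :
    w.partition = μ ↔ w.cycleType = μ.parts.filter (2 ≤ ·) := by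
  refine ⟨fun h => ?_, fun h => ?_⟩
  · rw [← h, Perm.filter_parts_partition_eq_cycleType]
  · ext1
    rw [w.partition.parts_eq_filter_add_replicate, μ.parts_eq_filter_add_replicate,
      Perm.filter_parts_partition_eq_cycleType, h]

theorem card_partition_eq_mul_centralizerCard (μ : (Fintype.card α).Partition) :
    (Finset.univ.filter fun w : Perm α => w.partition = μ).card * centralizerCard μ.parts =
      (Fintype.card α)! := by
  have h := Perm.card_of_cycleType_mul_eq α (μ.parts.filter (2 ≤ ·))
  rw [if_pos, mul_assoc _ (Multiset.prod _), ← centralizerCard,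
    ← centralizerCard_add_replicate_one, ← μ.parts_eq_filter_add_replicate] at h
  · simpa only [partition_eq_iff] using h
  · simp
  · refine ⟨?_, fun a ha => (Multiset.mem_filter.1 ha).2⟩
    have h1 := congrArg Multiset.sum (Multiset.filter_add_not (2 ≤ ·) μ.parts)
    rw [Multiset.sum_add, μ.parts_sum] at h1
    omega

variable {R : Type*} [CommRing R] [Algebra ℚ R]

/-- The cycle index `∑ c_μ / z_μ` of the symmetric group, evaluated at the sequence `c`. -/
noncomputable def cycleIndex (c : ℕ → R) (n : ℕ) : R :=
  ∑ μ : n.Partition, ((centralizerCard μ.parts : ℚ))⁻¹ • (μ.parts.map c).prod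

theorem sum_perm_eq_cycleIndex (c : ℕ → R) :
    ((Fintype.card α)! : ℚ)⁻¹ • ∑ w : Perm α, (w.partition.parts.map c).prod =
      cycleIndex c (Fintype.card α) := by
  rw [cycleIndex, ← Finset.sum_fiberwise_of_maps_to
    (t := (Finset.univ : Finset (Fintype.card α).Partition)) (g := fun w : Perm α => w.partition)
    (fun _ _ => Finset.mem_univ _), Finset.smul_sum]
  refine Finset.sum_congr rfl fun μ _ => ?_
  rw [Finset.sum_congr rfl (g := fun _ => (μ.parts.map c).prod)
    (fun w hw => by rw [(Finset.mem_filter.1 hw).2]), Finset.sum_const,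
    ← card_partition_eq_mul_centralizerCard μ, ← Nat.cast_smul_eq_nsmul ℚ, smul_smul]
  congr 1
  have h0 := Nat.factorial_ne_zero (Fintype.card α)
  rw [← card_partition_eq_mul_centralizerCard μ] at h0
  have h1 := Nat.cast_ne_zero (R := ℚ).2 (left_ne_zero_of_mul h0)
  push_cast
  rw [mul_inv, mul_comm, ← mul_assoc, mul_inv_cancel₀ h1, one_mul]

theorem sigma_partition_ext {x y : Σ p : ℕ × ℕ, p.2.Partition} (h : x.1 = y.1)
    (h' : x.2.parts = y.2.parts) : x = y := by
  obtain ⟨x, μ⟩ := x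
  obtain ⟨y, ν⟩ := y
  obtain rfl : x = y := h
  exact congrArg (Sigma.mk x) (Nat.Partition.ext h')

theorem natCast_mul_cycleIndex (c : ℕ → R) (n : ℕ) :
    (n : R) * cycleIndex c n = ∑ x ∈ Finset.HasAntidiagonal.antidiagonal n,
      (if x.1 = 0 then 0 else c x.1) * cycleIndex c x.2 := by
  have hμ : ∀ μ : n.Partition, (n : R) * ((centralizerCard μ.parts : ℚ)⁻¹ • (μ.parts.map c).prod) =
      ∑ k ∈ μ.parts.toFinset, ((centralizerCard (μ.parts.erase k) : ℚ)⁻¹ •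
        (c k * ((μ.parts.erase k).map c).prod)) := by
    intro μ
    have h1 : (n : R) = ∑ k ∈ μ.parts.toFinset, ((μ.parts.count k * k : ℕ) : R) := by
      rw [← Nat.cast_sum]
      congr 1
      conv_lhs => rw [← μ.parts_sum, Finset.sum_multiset_count]
      simp
    rw [h1, Finset.sum_mul]
    refine Finset.sum_congr rfl fun k hk => ?_
    rw [Multiset.mem_toFinset] at hk
    obtain ⟨s, hs⟩ := Multiset.exists_cons_of_mem hk
    have h0 : 0 ∉ s := fun h => by
      have := μ.parts_pos (i := 0) (by rw [hs]; exact Multiset.mem_cons_of_mem h)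
      omega
    have hk0 := μ.parts_pos hk
    rw [hs, Multiset.erase_cons_head, Multiset.map_cons, Multiset.prod_cons, centralizerCard_cons,
      Multiset.count_cons_self, ← nsmul_eq_mul, ← Nat.cast_smul_eq_nsmul ℚ, smul_smul]
    congr 1
    have := centralizerCard_pos h0
    push_cast
    field_simp
  rw [cycleIndex, Finset.mul_sum, Finset.sum_congr rfl fun μ _ => hμ μ]
  simp only [cycleIndex, Finset.mul_sum]
  rw [← Finset.sum_filter_of_ne (p := fun x : ℕ × ℕ => x.1 ≠ 0)]
  swap
  · intro x _ hx h0
    simp [h0] at hx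
  rw [Finset.sum_sigma', Finset.sum_sigma']
  refine Finset.sum_bij
    (fun (x : Σ _ : n.Partition, ℕ) hx => ⟨(x.2, n - x.2), ⟨x.1.parts.erase x.2,
      fun h => x.1.parts_pos (Multiset.mem_of_mem_erase h), ?_⟩⟩) ?_ ?_ ?_ ?_
  · simp only [Finset.mem_sigma, Finset.mem_univ, Multiset.mem_toFinset, true_and] at hx
    have := congrArg Multiset.sum (Multiset.cons_erase hx)
    rw [Multiset.sum_cons, x.1.parts_sum] at this
    omega
  · intro x hx
    simp only [Finset.mem_sigma, Finset.mem_univ, Multiset.mem_toFinset, true_and] at hx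
    have h1 := x.1.le_of_mem_parts hx
    have h2 := x.1.parts_pos hx
    simp only [Finset.mem_sigma, Finset.mem_filter, Finset.HasAntidiagonal.mem_antidiagonal,
      Finset.mem_univ, and_true]
    omega
  · rintro ⟨μ, k⟩ hx ⟨ν, l⟩ hy h
    simp only [Finset.mem_sigma, Finset.mem_univ, Multiset.mem_toFinset, true_and] at hx hy
    have h1 : k = l := congrArg (fun z => z.1.1) h
    have h2 : μ.parts.erase k = ν.parts.erase l := congrArg (fun z => z.2.parts) h
    subst h1
    rw [Nat.Partition.ext (x := μ) (y := ν)]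
    rw [← Multiset.cons_erase hx, h2, Multiset.cons_erase hy]
  · rintro ⟨⟨a, b⟩, ν⟩ hx
    simp only [Finset.mem_sigma, Finset.mem_filter, Finset.HasAntidiagonal.mem_antidiagonal,
      Finset.mem_univ, and_true] at hx
    obtain ⟨h1, h2⟩ := hx
    refine ⟨⟨⟨a ::ₘ ν.parts, fun h => ?_, by rw [Multiset.sum_cons, ν.parts_sum]; exact h1⟩, a⟩,
      by simp, sigma_partition_ext ?_ (by simp)⟩
    · rcases Multiset.mem_cons.1 h with rfl | h
      · exact Nat.pos_of_ne_zero h2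
      · exact ν.parts_pos h
    · simp only [Prod.mk.injEq, true_and]
      omega
  · rintro ⟨μ, k⟩ hx
    simp only [Finset.mem_sigma, Finset.mem_univ, Multiset.mem_toFinset, true_and] at hx
    have h2 := μ.parts_pos hx
    rw [if_neg (by simpa using h2.ne'), mul_smul_comm]

theorem hasLogDeriv_cycleIndex (c : ℕ → R) :
    HasLogDeriv (mk fun k => if k = 0 then 0 else c k) (mk (cycleIndex c)) := by
  rw [hasLogDeriv_iff]
  refine ⟨?_, fun n => ?_⟩
  · simp [cycleIndex, centralizerCard]
  · simp only [coeff_mk, natCast_mul_cycleIndex]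

end CycleIndex

/-! ### The permutation character on parking functions -/

section FixedFunctions

open Equiv Equiv.Perm

variable {α : Type*} [Fintype α] [DecidableEq α]

/-- The cycle of `w` containing `x`, where a fixed point is its own cycle. -/
def cycleIdx (w : Perm α) (x : α) : w.cycleFactorsFinset ⊕ {x // w x = x} :=
  if h : w x = x then .inr ⟨x, h⟩
  else .inl ⟨w.cycleOf x, cycleOf_mem_cycleFactorsFinset_iff.2 (mem_support.2 h)⟩

theorem cycleIdx_apply (w : Perm α) (x : α) : cycleIdx w (w x) = cycleIdx w x := by
  by_cases h : w x = x
  · rw [h]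
  · have h' : w (w x) ≠ w x := fun h' => h (w.injective h')
    rw [cycleIdx, cycleIdx, dif_neg h, dif_neg h']
    simp

theorem sameCycle_of_cycleIdx_eq {w : Perm α} {x y : α} (h : cycleIdx w x = cycleIdx w y) :
    w.SameCycle x y := by
  rw [cycleIdx, cycleIdx] at h
  split_ifs at h with hx hy hy
  · simp only [Sum.inr.injEq, Subtype.mk.injEq] at h
    rw [h]
  · simp only [Sum.inl.injEq, Subtype.mk.injEq] at h
    exact (sameCycle_iff_cycleOf_eq_of_mem_support (mem_support.2 hx) (mem_support.2 hy)).2 h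

theorem cycleIdx_surjective (w : Perm α) : Function.Surjective (cycleIdx w) := by
  rintro (⟨c, hc⟩ | ⟨x, hx⟩)
  · obtain ⟨x, hx⟩ := (mem_cycleFactorsFinset_iff.1 hc).1.nonempty_support
    have h1 := cycle_is_cycleOf hx hc
    have h2 : w x ≠ x := by
      rw [← mem_support]
      exact mem_cycleFactorsFinset_support_le hc hx
    exact ⟨x, by rw [cycleIdx, dif_neg h2]; simp [h1]⟩
  · exact ⟨x, by rw [cycleIdx, dif_pos hx]⟩

theorem card_cycleIdx (w : Perm α) :
    Fintype.card (w.cycleFactorsFinset ⊕ {x // w x = x}) = w.partition.parts.card := by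
  have h := card_fixedPoints w
  rw [sum_cycleType] at h
  rw [Fintype.card_sum, parts_partition, Multiset.card_add, Multiset.card_replicate, ← h,
    cycleType_def, Multiset.card_map, Fintype.card_coe, Finset.card_val]
  rfl

theorem card_fixed_functions (w : Perm α) (β : Type*) [Fintype β] [DecidableEq β] :
    (Finset.univ.filter fun f : α → β => ∀ i, f (w⁻¹ i) = f i).card =
      Fintype.card β ^ w.partition.parts.card := by
  rw [← card_cycleIdx, ← Fintype.card_fun, ← Finset.card_univ,
    ← Finset.card_image_of_injective _ (cycleIdx_surjective w).injective_comp_right]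
  congr 1
  ext f
  simp only [Finset.mem_filter, Finset.mem_univ, true_and, Finset.mem_image]
  constructor
  · intro hf
    have hf' : ∀ i, f (w i) = f i := fun i => by simpa using (hf (w i)).symm
    have hs : ∀ x y, w.SameCycle x y → f x = f y := by
      rintro x _ ⟨k, rfl⟩
      induction k using Int.induction_on with
      | zero => simp
      | succ k ih => rw [add_comm, zpow_add, zpow_one, Perm.mul_apply, hf', ih]
      | pred k ih => rw [sub_eq_neg_add, zpow_add, zpow_neg_one, Perm.mul_apply, hf, ih]
    refine ⟨f ∘ Function.surjInv (cycleIdx_surjective w), funext fun x => hs _ _ ?_⟩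
    exact sameCycle_of_cycleIdx_eq (Function.surjInv_eq _ _)
  · rintro ⟨g, rfl⟩ i
    have := cycleIdx_apply w (w⁻¹ i)
    simpa using congrArg g this.symm

end FixedFunctions

section Parking

variable {n : ℕ}

theorem isParkingFunction_iff {a : Fin n → ℕ} : IsParkingFunction a ↔
    (∀ i, 1 ≤ a i) ∧ ∀ k ≤ n, k ≤ (Finset.univ.filter fun i => a i ≤ k).card := by
  refine and_congr Iff.rfl ⟨fun h k hk => ?_, fun h i => ?_⟩
  · calc k = ((Finset.univ : Finset (Fin k)).map ((Fin.castLEEmb hk).trans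
          (Tuple.sort a).toEmbedding)).card := by simp
      _ ≤ _ := Finset.card_le_card fun x hx => by
        simp only [Finset.mem_map, Finset.mem_univ, true_and] at hx
        obtain ⟨j, rfl⟩ := hx
        rw [Finset.mem_filter]
        refine ⟨Finset.mem_univ _, (h _).trans ?_⟩
        exact j.2
  · by_contra! hi
    have h1 := h (i + 1) i.2
    have h2 : (Finset.univ.filter fun x => a x ≤ (i : ℕ) + 1) ⊆
        (Finset.Iio i).map (Tuple.sort a).toEmbedding := by
      intro x hx
      rw [Finset.mem_filter] at hx
      refine Finset.mem_map.2 ⟨(Tuple.sort a).symm x, ?_, by simp⟩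
      rw [Finset.mem_Iio]
      by_contra! hle
      have := Tuple.monotone_sort a hle
      simp only [Function.comp_apply, Equiv.apply_symm_apply] at this
      omega
    have := Finset.card_le_card h2
    rw [Finset.card_map, Fin.card_Iio] at this
    omega

theorem IsParkingFunction.le {a : Fin n → ℕ} (h : IsParkingFunction a) (i : Fin n) : a i ≤ n := by
  have := (isParkingFunction_iff.1 h).2 n le_rfl
  have h2 : (Finset.univ.filter fun i => a i ≤ n) = Finset.univ :=
    Finset.eq_univ_of_card _ (le_antisymm (Finset.card_le_univ _) (by simpa using this))
  have hi : i ∈ Finset.univ.filter fun i => a i ≤ n := h2.symm ▸ Finset.mem_univ i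
  exact (Finset.mem_filter.1 hi).2

/-- The sequence of positive integers obtained from `f` by a cyclic shift of the values. -/
def cyclicShift (f : Fin n → Fin (n + 1)) (c : Fin (n + 1)) : Fin n → ℕ :=
  fun j => ((f j - c : Fin (n + 1)) : ℕ) + 1

theorem fin_sub_val {N : ℕ} (a b : Fin N) :
    (b ≤ a ∧ ((a - b : Fin N) : ℕ) = a - b) ∨ (a < b ∧ ((a - b : Fin N) : ℕ) = N + a - b) := by
  rcases le_or_gt b a with h | h
  · exact .inl ⟨h, Fin.coe_sub_iff_le.2 h⟩
  · exact .inr ⟨h, Fin.coe_sub_iff_lt.2 h⟩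

theorem card_cyclicShift_le (f : Fin n → Fin (n + 1)) (c : Fin (n + 1)) {k : ℕ}
    (hk : c + k ≤ n + 1) :
    (Finset.univ.filter fun j => cyclicShift f c j ≤ k).card +
      (Finset.univ.filter fun j => (f j : ℕ) < c).card =
      (Finset.univ.filter fun j => (f j : ℕ) < c + k).card := by
  simp only [Finset.card_filter, ← Finset.sum_add_distrib]
  refine Finset.sum_congr rfl fun j _ => ?_
  have := fin_sub_val (f j) c
  have := (f j).2
  rw [cyclicShift]
  split_ifs <;> omega

theorem card_cyclicShift_gt (f : Fin n → Fin (n + 1)) (c : Fin (n + 1)) {k m : ℕ}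
    (hk : k ≤ n) (hm : c + k = n + 1 + m) :
    (Finset.univ.filter fun j => cyclicShift f c j ≤ k).card +
      (Finset.univ.filter fun j => (f j : ℕ) < c).card =
      n + (Finset.univ.filter fun j => (f j : ℕ) < m).card := by
  have hn : n = ∑ _j : Fin n, 1 := by simp
  conv_rhs => lhs; rw [hn]
  simp only [Finset.card_filter, ← Finset.sum_add_distrib]
  refine Finset.sum_congr rfl fun j _ => ?_
  have := fin_sub_val (f j) c
  have := (f j).2
  rw [cyclicShift]
  split_ifs <;> omega

theorem isParkingFunction_cyclicShift_iff (f : Fin n → Fin (n + 1)) (c : Fin (n + 1)) :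
    IsParkingFunction (cyclicShift f c) ↔ ∀ m ≤ n,
      (Finset.univ.filter fun j => (f j : ℕ) < c).card + m + (if m < c then 1 else 0) ≤
        (Finset.univ.filter fun j => (f j : ℕ) < m).card + c := by
  rw [isParkingFunction_iff, and_iff_right fun i => by simp [cyclicShift]]
  have hc := c.2
  constructor
  · intro h m hm
    by_cases hmc : m < c
    · have h1 := h (n + 1 + m - c) (by omega)
      have h2 := card_cyclicShift_gt f c (k := n + 1 + m - c) (m := m) (by omega) (by omega)
      rw [if_pos hmc]
      omega
    · have h1 := h (m - c) (by omega)
      have h2 := card_cyclicShift_le f c (k := m - c) (by omega)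
      rw [show (c : ℕ) + (m - c) = m by omega] at h2
      rw [if_neg hmc]
      omega
  · intro h k hk
    by_cases hck : c + k ≤ n
    · have h1 := h (c + k) hck
      have h2 := card_cyclicShift_le f c (k := k) (by omega)
      rw [if_neg (by omega)] at h1
      omega
    · have h1 := h (c + k - (n + 1)) (by omega)
      have h2 := card_cyclicShift_gt f c (k := k) (m := c + k - (n + 1)) hk (by omega)
      rw [if_pos (by omega)] at h1
      omega

theorem existsUnique_cyclicShift (f : Fin n → Fin (n + 1)) :
    ∃! c, IsParkingFunction (cyclicShift f c) := by
  simp only [isParkingFunction_cyclicShift_iff]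
  generalize hU : (fun m => (Finset.univ.filter fun j => (f j : ℕ) < m).card) = U
  have hU' : ∀ m, (Finset.univ.filter fun j => (f j : ℕ) < m).card = U m := fun m => by rw [← hU]
  simp only [hU']
  obtain ⟨c, hmem, hc⟩ := Finset.exists_min_image (Finset.range (n + 1))
    (fun m => toLex ((U m : ℤ) - m, m)) ⟨0, by simp⟩
  have hD : ∀ m ≤ n, (U c : ℤ) - c < U m - m ∨ (U c : ℤ) - c = U m - m ∧ c ≤ m := fun m hm =>
    Prod.Lex.toLex_le_toLex.1 (hc m (by simp; omega))
  have hcn : c < n + 1 := by simpa using hmem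
  refine ⟨⟨c, hcn⟩, fun m hm => ?_, fun c' hc' => ?_⟩
  · have := hD m hm
    dsimp only
    split_ifs <;> omega
  · have h1 := hD c' (by omega)
    have h2 := hc' c (by omega)
    ext
    dsimp only
    split_ifs at h2 <;> omega

theorem parkingCharacter_mul (w : Equiv.Perm (Fin n)) :
    parkingCharacter w * (n + 1) = (n + 1) ^ w.partition.parts.card := by
  classical
  have h := card_fixed_functions w (Fin (n + 1))
  rw [Fintype.card_fin] at h
  rw [← h, Finset.card_eq_sum_ones, Finset.sum_congr rfl fun f _ =>
    (Finset.card_eq_one.2 (by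
      obtain ⟨c, hc⟩ := existsUnique_cyclicShift f
      refine ⟨c, ?_⟩
      ext x
      simp only [Finset.mem_filter, Finset.mem_univ, true_and, Finset.mem_singleton]
      exact ⟨fun hx => hc.2 x hx, fun hx => hx ▸ hc.1⟩) :
      (Finset.univ.filter fun c => IsParkingFunction (cyclicShift f c)).card = 1).symm]
  simp only [Finset.card_filter]
  rw [Finset.sum_comm]
  simp only [← Finset.card_filter, Finset.filter_filter]
  have : ∀ c : Fin (n + 1), (Finset.univ.filter fun f : Fin n → Fin (n + 1) =>
      (∀ i, f (w⁻¹ i) = f i) ∧ IsParkingFunction (cyclicShift f c)).card = parkingCharacter w := by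
    intro c
    rw [parkingCharacter, ← Set.ncard_coe_finset]
    refine Set.ncard_congr (fun f _ => cyclicShift f c) ?_ ?_ ?_
    · intro f hf
      simp only [Finset.coe_filter, Finset.mem_univ, true_and, Set.mem_ofPred_eq] at hf
      exact ⟨hf.2, fun i => by rw [cyclicShift, cyclicShift, hf.1]⟩
    · intro f g _ _ hfg
      funext j
      have := congrFun hfg j
      simp only [cyclicShift, add_left_inj, Fin.val_inj, sub_left_inj] at this
      exact this
    · rintro a ⟨ha, hw⟩
      have h1 := fun j => ha.1 j
      have h2 := fun j => ha.le j
      have h3 : cyclicShift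
          (fun j => (⟨a j - 1, by have := h2 j; omega⟩ : Fin (n + 1)) + c) c = a := by
        funext j
        have := h1 j
        simp only [cyclicShift, add_sub_cancel_right]
        omega
      refine ⟨_, ?_, h3⟩
      simp only [Finset.coe_filter, Finset.mem_univ, true_and, Set.mem_ofPred_eq]
      refine ⟨fun i => by simp only [hw], ?_⟩
      rw [h3]
      exact ha
  refine Eq.trans ?_ (Finset.sum_congr rfl fun c _ => (Eq.trans ?_ (this c)).symm)
  rotate_left
  · congr
  · simp [mul_comm]

end Parking

/-! ### The parking function symmetric function as a coefficient of a power of a series -/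

section ParkingSymm

variable {R : Type*} [CommRing R] [Algebra ℚ R]

theorem map_parkingSymm (φ : MvPolynomial ℕ ℚ →ₐ[ℚ] R) (n : ℕ) :
    φ (parkingSymm n) =
      ((n : ℚ) + 1)⁻¹ • cycleIndex (fun k => ((n + 1 : ℕ) : R) * φ (MvPolynomial.X k)) n := by
  have h := sum_perm_eq_cycleIndex (α := Fin n)
    (fun k => ((n + 1 : ℕ) : R) * φ (MvPolynomial.X k))
  simp only [Fintype.card_fin] at h
  rw [← h, parkingSymm, frobeniusCharacteristic, map_smul, map_sum, smul_comm]
  congr 1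
  rw [Finset.smul_sum]
  refine Finset.sum_congr rfl fun w _ => ?_
  have hw : (parkingCharacter w : ℚ) =
      ((n : ℚ) + 1)⁻¹ * ((n : ℚ) + 1) ^ w.partition.parts.card := by
    have := parkingCharacter_mul w
    rw [eq_inv_mul_iff_mul_eq₀ (by positivity), mul_comm]
    exact_mod_cast this
  rw [map_smul, hw, mul_smul, Multiset.prod_map_mul, Multiset.map_const', Multiset.prod_replicate,
    map_multiset_prod, Multiset.map_map, Algebra.smul_def (_ ^ _)]
  congr 2
  simp

theorem map_parkingSymm_eq_coeff (φ : MvPolynomial ℕ ℚ →ₐ[ℚ] R) {A : R⟦X⟧}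
    (hA : HasLogDeriv (mk fun k => if k = 0 then 0 else φ (MvPolynomial.X k)) A) (n : ℕ) :
    φ (parkingSymm n) = ((n : ℚ) + 1)⁻¹ • coeff n (A ^ (n + 1)) := by
  have h := hasLogDeriv_cycleIndex (fun k => ((n + 1 : ℕ) : R) * φ (MvPolynomial.X k))
  have h2 := hA.pow (n + 1)
  rw [map_parkingSymm, h2.unique (B := mk (cycleIndex _)), coeff_mk]
  convert h using 1
  ext k
  rw [← nsmul_eq_mul, map_nsmul, coeff_mk, coeff_mk, nsmul_eq_mul]
  split_ifs <;> simp

end ParkingSymm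

/-! ### The generating series of the functions `q_n` -/

section Q

theorem coeff_q (n : ℕ) (d : ℕ →₀ ℕ) :
    MvPowerSeries.coeff d (q n) = if d.degree = n then 2 ^ d.support.card else 0 := by
  classical
  have h1 : MvPowerSeries.coeff d (q n) =
      ∑ x ∈ Finset.HasAntidiagonal.antidiagonal d,
        if d.degree = n ∧ ∀ i, x.1 i ≤ 1 then (1 : ℚ) else 0 := by
    simp only [q, map_sum, MvPowerSeries.coeff_mul]
    rw [Finset.sum_comm]
    refine Finset.sum_congr rfl fun x hx => ?_
    rw [Finset.HasAntidiagonal.mem_antidiagonal] at hx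
    have hd : d.degree = x.1.degree + x.2.degree := by rw [← hx, map_add]
    change ∑ k ∈ Finset.range (n + 1), (if x.1.degree = k ∧ ∀ i, x.1 i ≤ 1 then (1 : ℚ) else 0) *
      (if x.2.degree = n - k then 1 else 0) = _
    by_cases hx1 : ∀ i, x.1 i ≤ 1
    · simp only [hx1, and_true, implies_true]
      by_cases hn : d.degree = n
      · rw [Finset.sum_eq_single_of_mem x.1.degree (by simp; omega)
          (fun k _ hk => by rw [if_neg hk.symm, zero_mul])]
        rw [if_pos rfl, if_pos (by omega), if_pos hn, one_mul]
      · rw [if_neg hn]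
        refine Finset.sum_eq_zero fun k hk => ?_
        have := Finset.mem_range.1 hk
        split_ifs <;> first | omega | simp
    · simp [hx1]
  rw [h1]
  by_cases hn : d.degree = n
  swap
  · simp [hn]
  simp only [hn, true_and, if_true]
  rw [← Finset.sum_filter, Finset.sum_const, nsmul_eq_mul, mul_one]
  norm_cast
  rw [← Finset.card_powerset]
  refine Finset.card_nbij' (fun x => x.1.support)
    (fun s => (Finsupp.indicator s fun _ _ => 1, d - Finsupp.indicator s fun _ _ => 1)) ?_ ?_ ?_ ?_
  · intro x hx
    simp only [Finset.coe_filter, Finset.HasAntidiagonal.mem_antidiagonal, Set.mem_ofPred_eq] at hx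
    simp only [Finset.coe_powerset, Set.mem_preimage, Set.mem_powerset_iff, Finset.coe_subset]
    refine Finsupp.support_mono ?_
    rw [← hx.1]
    exact le_self_add
  · intro s hs
    simp only [Finset.coe_powerset, Set.mem_preimage, Set.mem_powerset_iff, Finset.coe_subset] at hs
    simp only [Finset.coe_filter, Finset.HasAntidiagonal.mem_antidiagonal, Set.mem_ofPred_eq]
    refine ⟨add_tsub_cancel_of_le fun i => ?_, fun i => ?_⟩
    · rw [Finsupp.indicator_apply]
      split_ifs with hi
      · exact Nat.one_le_iff_ne_zero.2 (Finsupp.mem_support_iff.1 (hs hi))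
      · exact Nat.zero_le _
    · rw [Finsupp.indicator_apply]
      split_ifs <;> simp
  · intro x hx
    simp only [Finset.coe_filter, Finset.HasAntidiagonal.mem_antidiagonal, Set.mem_ofPred_eq] at hx
    have h2 : (Finsupp.indicator x.1.support fun _ _ => 1 : ℕ →₀ ℕ) = x.1 := by
      ext i
      rw [Finsupp.indicator_apply]
      have := hx.2 i
      split_ifs with hi
      · have := Finsupp.mem_support_iff.1 hi
        omega
      · exact (Finsupp.notMem_support_iff.1 hi).symm
    ext1
    · exact h2
    · dsimp only
      rw [h2, ← hx.1, add_tsub_cancel_left]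
  · intro s hs
    ext i
    simp [Finsupp.indicator_apply]

theorem q_zero : q 0 = 1 := by
  ext d
  rw [coeff_q, MvPowerSeries.coeff_one]
  by_cases hd : d = 0
  · simp [hd]
  · rw [if_neg hd, if_neg (by rwa [Finsupp.degree_eq_zero_iff])]

theorem two_mul_coeff_psum_mul_q {k : ℕ} (hk : k ≠ 0) (m : ℕ) (d : ℕ →₀ ℕ) :
    2 * MvPowerSeries.coeff d (psum k * q m) = if d.degree = k + m then
      2 ^ d.support.card * ∑ i ∈ d.support, (if k < d i then 2 else if k = d i then 1 else 0)
      else 0 := by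
  classical
  have hterm : ∀ i ∈ d.support, k ≤ d i →
      2 * MvPowerSeries.coeff (d - Finsupp.single i k) (q m) = if d.degree = k + m then
        2 ^ d.support.card * (if k < d i then 2 else if k = d i then 1 else (0 : ℚ)) else 0 := by
    intro i hi hki
    have hle : Finsupp.single i k ≤ d := by simpa using hki
    have hdeg : (d - Finsupp.single i k).degree + k = d.degree := by
      conv_rhs => rw [← tsub_add_cancel_of_le hle, map_add, Finsupp.degree_single]
    rw [coeff_q, if_congr (show _ ↔ d.degree = k + m by omega) rfl rfl]
    split_ifs with h1 h2 h3
    · rw [mul_comm]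
      congr 3
      ext j
      simp only [Finsupp.mem_support_iff, Finsupp.coe_tsub, Pi.sub_apply, Finsupp.single_apply]
      split_ifs with hj
      · subst hj; omega
      · simp
    · have : (d - Finsupp.single i k).support = d.support.erase i := by
        ext j
        simp only [Finsupp.mem_support_iff, Finsupp.coe_tsub, Pi.sub_apply, Finsupp.single_apply,
          Finset.mem_erase]
        split_ifs with hj
        · subst hj; simp; omega
        · simp [Ne.symm hj]
      rw [this, ← Finset.card_erase_add_one hi, pow_succ]
      ring
    · omega
    · simp
  rw [MvPowerSeries.coeff_mul]
  have h1 : ∑ x ∈ Finset.HasAntidiagonal.antidiagonal d,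
      MvPowerSeries.coeff x.1 (psum k) * MvPowerSeries.coeff x.2 (q m) =
      ∑ i ∈ d.support.filter fun i => k ≤ d i,
        MvPowerSeries.coeff (d - Finsupp.single i k) (q m) := by
    symm
    refine Finset.sum_of_injOn (fun i => (Finsupp.single i k, d - Finsupp.single i k)) ?_ ?_ ?_ ?_
    · intro i _ j _ hij
      simpa [Finsupp.single_left_inj hk] using congrArg Prod.fst hij
    · intro i hi
      simp only [Finset.coe_filter, Set.mem_ofPred_eq] at hi
      simp only [Finset.mem_coe, Finset.HasAntidiagonal.mem_antidiagonal]
      exact add_tsub_cancel_of_le (by simpa using hi.2)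
    · intro x hx hx'
      rw [Finset.HasAntidiagonal.mem_antidiagonal] at hx
      change (if ∃ i : ℕ, x.1 = Finsupp.single i k then (1 : ℚ) else 0) * _ = 0
      rw [if_neg, zero_mul]
      rintro ⟨i, hi⟩
      refine hx' ⟨i, ?_, ?_⟩
      · have : k ≤ d i := by rw [← hx, hi]; simp
        simp only [Finset.coe_filter, Set.mem_ofPred_eq, Finsupp.mem_support_iff]
        omega
      · ext1
        · exact hi.symm
        · dsimp only
          rw [← hi, ← hx, add_tsub_cancel_left]
    · intro i _
      change _ = (if ∃ j : ℕ, Finsupp.single i k = Finsupp.single j k then (1 : ℚ) else 0) * _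
      rw [if_pos ⟨i, rfl⟩, one_mul]
  rw [h1, Finset.mul_sum, Finset.sum_congr rfl fun i hi =>
    hterm i (Finset.mem_filter.1 hi).1 (Finset.mem_filter.1 hi).2]
  split_ifs with h
  · rw [Finset.mul_sum, Finset.sum_filter]
    refine Finset.sum_congr rfl fun i _ => ?_
    split_ifs <;> first | omega | simp
  · simp

theorem sum_odd_le {m N : ℕ} (h : m ≤ N) : ∑ k ∈ Finset.range (N + 1),
    (if Odd k then if k < m then 2 else if k = m then 1 else 0 else 0) = (m : ℚ) := by
  have h1 : ∀ m, ∑ k ∈ Finset.range m, (if Odd k then (2 : ℚ) else 0) + (if Odd m then 1 else 0) =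
      m := by
    intro m
    induction m with
    | zero => simp
    | succ m ih =>
      rw [Finset.sum_range_succ]
      push_cast
      rw [← ih]
      by_cases hm : Odd m
      · simp [hm, Nat.odd_add_one]; ring
      · simp [hm, Nat.odd_add_one]
  rw [← Finset.sum_subset (s₁ := Finset.range (m + 1))
    (Finset.range_subset_range.2 (by omega)), Finset.sum_range_succ]
  · rw [← h1 m]
    congr 1
    · refine Finset.sum_congr rfl fun k hk => ?_
      rw [if_pos (Finset.mem_range.1 hk)]
    · simp
  · intro k _ hk
    rw [Finset.mem_range] at hk
    rw [if_neg (by omega : ¬ k < m), if_neg (by omega : ¬ k = m), ite_self]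

/-- The series `∑ q_n t^n`. -/
noncomputable def qSeries : (MvPowerSeries ℕ ℚ)⟦X⟧ := mk q

/-- The series `2 ∑ p_k t^k` over odd `k`. -/
noncomputable def oddPsumSeries : (MvPowerSeries ℕ ℚ)⟦X⟧ :=
  mk fun k => if Odd k then 2 * psum k else 0

theorem natCast_mul_q (n : ℕ) : (n : MvPowerSeries ℕ ℚ) * q n =
    ∑ x ∈ Finset.HasAntidiagonal.antidiagonal n, (if Odd x.1 then 2 * psum x.1 else 0) * q x.2 := by
  ext d
  rw [← nsmul_eq_mul, map_nsmul, map_sum, coeff_q]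
  have h : ∀ x ∈ Finset.HasAntidiagonal.antidiagonal n,
      MvPowerSeries.coeff d ((if Odd x.1 then 2 * psum x.1 else 0) * q x.2) =
      if d.degree = n then 2 ^ d.support.card * ∑ i ∈ d.support,
        (if Odd x.1 then if x.1 < d i then 2 else if x.1 = d i then 1 else 0 else 0) else 0 := by
    intro x hx
    rw [Finset.HasAntidiagonal.mem_antidiagonal] at hx
    by_cases ho : Odd x.1
    · simp only [ho, if_true]
      rw [mul_assoc, two_mul, map_add, ← two_mul,
        two_mul_coeff_psum_mul_q (by rintro h; simp [h] at ho), hx]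
    · simp [ho]
  rw [Finset.sum_congr rfl h]
  split_ifs with hd
  · rw [← Finset.mul_sum, Finset.sum_comm, nsmul_eq_mul, mul_comm]
    congr 1
    rw [← hd, Finsupp.degree_apply, Nat.cast_sum]
    refine Finset.sum_congr rfl fun i hi => ?_
    rw [Finset.Nat.sum_antidiagonal_eq_sum_range_succ_mk]
    exact (sum_odd_le (Finset.single_le_sum (f := d) (fun _ _ => Nat.zero_le _) hi)).symm
  · simp

theorem hasLogDeriv_qSeries : HasLogDeriv oddPsumSeries qSeries := by
  rw [hasLogDeriv_iff]
  simp only [qSeries, oddPsumSeries, coeff_mk]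
  exact ⟨q_zero, natCast_mul_q⟩

theorem qSeries_mul_rescale : qSeries * rescale (-1) qSeries = 1 := by
  have h := hasLogDeriv_qSeries.mul (hasLogDeriv_qSeries.rescale (-1))
  refine h.unique ?_
  convert HasLogDeriv.one using 1
  ext1 k
  rw [map_add, coeff_rescale, oddPsumSeries, coeff_mk, map_zero]
  split_ifs with hk
  · simp [hk.neg_one_pow]
  · simp

theorem qTwo_self {r : ℕ} (hr : r ≠ 0) : qTwo r r = 0 := by
  have h := congrArg (coeff (2 * r)) qSeries_mul_rescale
  rw [coeff_mul, coeff_one, if_neg (by omega)] at h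
  simp only [coeff_rescale, qSeries, coeff_mk] at h
  rw [Finset.Nat.sum_antidiagonal_eq_sum_range_succ_mk, show (2 * r).succ = r + (r + 1) by omega,
    Finset.sum_range_add, Finset.sum_range_succ', ← Finset.sum_range_reflect] at h
  have h1 : ∀ x ∈ Finset.range r, q (r - 1 - x) * ((-1) ^ (2 * r - (r - 1 - x)) *
      q (2 * r - (r - 1 - x))) =
      (-1) ^ r * ((-1) ^ (x + 1) * (q (r + (x + 1)) * q (r - (x + 1)))) := by
    intro x hx
    have := Finset.mem_range.1 hx
    rw [show 2 * r - (r - 1 - x) = r + (x + 1) by omega, show r - 1 - x = r - (x + 1) by omega]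
    ring
  have h2 : ∀ x ∈ Finset.range r, q (r + (x + 1)) * ((-1) ^ (2 * r - (r + (x + 1))) *
      q (2 * r - (r + (x + 1)))) =
      (-1) ^ r * ((-1) ^ (x + 1) * (q (r + (x + 1)) * q (r - (x + 1)))) := by
    intro x hx
    have := Finset.mem_range.1 hx
    have h3 : ((-1) ^ r : MvPowerSeries ℕ ℚ) * (-1) ^ (x + 1) = (-1) ^ (r - (x + 1)) := by
      rw [← pow_add, show r + (x + 1) = (r - (x + 1)) + 2 * (x + 1) by omega, pow_add, pow_mul]
      simp
    rw [show 2 * r - (r + (x + 1)) = r - (x + 1) by omega, ← h3]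
    ring
  rw [Finset.sum_congr rfl h1, Finset.sum_congr rfl h2, ← Finset.mul_sum] at h
  have h4 : ((-1) ^ r : MvPowerSeries ℕ ℚ) * (-1) ^ r = 1 := by
    rw [← mul_pow]; simp
  rw [add_zero, show 2 * r - r = r by omega] at h
  rw [qTwo, ← Finset.Ico_add_one_right_eq_Icc, Finset.sum_Ico_eq_sum_range, Nat.add_sub_cancel]
  simp only [add_comm 1]
  dsimp only at h
  linear_combination (-1) ^ r * h - (q r * q r + 2 * ∑ i ∈ Finset.range r,
    (-1) ^ (i + 1) * (q (r + (i + 1)) * q (r - (i + 1)))) * h4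

end Q

theorem shiftedParkingSymm_eq_coeff (n : ℕ) :
    shiftedParkingSymm n = ((n : ℚ) + 1)⁻¹ • coeff n (qSeries ^ (n + 1)) := by
  refine map_parkingSymm_eq_coeff (ofPowerSums.comp shiftify) ?_ n
  convert hasLogDeriv_qSeries using 1
  ext1 k
  rw [coeff_mk, oddPsumSeries, coeff_mk]
  rcases Nat.eq_zero_or_pos k with rfl | hk
  · simp
  · rw [if_neg hk.ne']
    by_cases ho : Odd k <;> simp [shiftify, ofPowerSums, ho]

/-! ### Schur's `Q`-functions span the products of the functions `q_n` -/

section Span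

/-- The product of the functions `q_k` over the elements `k` of `s`. -/
noncomputable def qProd (s : Multiset ℕ) : MvPowerSeries ℕ ℚ := (s.map q).prod

/-- The span of the products `∏ q_{s_i}` with `∑ s_i = a` and `∑ s_i² ≥ k`. -/
noncomputable def qSpan (a k : ℕ) : Submodule ℚ (MvPowerSeries ℕ ℚ) :=
  Submodule.span ℚ {f | ∃ s : Multiset ℕ, s.sum = a ∧ k ≤ (s.map (· ^ 2)).sum ∧ qProd s = f}

theorem qProd_mem_qSpan {s : Multiset ℕ} {a k : ℕ} (ha : s.sum = a)
    (hk : k ≤ (s.map (· ^ 2)).sum) : qProd s ∈ qSpan a k :=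
  Submodule.subset_span ⟨s, ha, hk, rfl⟩

theorem qSpan_anti {a k l : ℕ} (h : k ≤ l) : qSpan a l ≤ qSpan a k :=
  Submodule.span_mono fun _ ⟨s, ha, hl, hs⟩ => ⟨s, ha, h.trans hl, hs⟩

theorem mul_mem_qSpan {a b k l : ℕ} {f g : MvPowerSeries ℕ ℚ} (hf : f ∈ qSpan a k)
    (hg : g ∈ qSpan b l) : f * g ∈ qSpan (a + b) (k + l) := by
  have h := Submodule.mul_mem_mul hf hg
  rw [qSpan, qSpan, Submodule.span_mul_span] at h
  refine Submodule.span_mono ?_ h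
  rintro _ ⟨_, ⟨s, hs, hs', rfl⟩, _, ⟨t, ht, ht', rfl⟩, rfl⟩
  refine ⟨s + t, by simp [hs, ht], ?_, by simp [qProd]⟩
  rw [Multiset.map_add, Multiset.sum_add]
  exact add_le_add hs' ht'

theorem q_mem_qSpan (r : ℕ) : q r ∈ qSpan r (r ^ 2) := by
  have := qProd_mem_qSpan (s := {r}) (a := r) (k := r ^ 2) (by simp) (by simp)
  simpa [qProd] using this

theorem neg_one_pow_mul_mem {V : Submodule ℚ (MvPowerSeries ℕ ℚ)} {f : MvPowerSeries ℕ ℚ}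
    (hf : f ∈ V) (i : ℕ) : (-1) ^ i * f ∈ V := by
  rcases neg_one_pow_eq_or (MvPowerSeries ℕ ℚ) i with h | h <;> simp [h, hf]

theorem qTwo_sub_mem_qSpan {r s : ℕ} (h : s ≤ r) :
    qTwo r s - q r * q s ∈ qSpan (r + s) (r ^ 2 + s ^ 2 + 1) := by
  rw [qTwo, add_sub_cancel_left, two_mul]
  refine (fun hx => Submodule.add_mem _ hx hx) (Submodule.sum_mem _ fun i hi => ?_)
  refine neg_one_pow_mul_mem ?_ i
  rw [Finset.mem_Icc] at hi
  have h1 := mul_mem_qSpan (q_mem_qSpan (r + i)) (q_mem_qSpan (s - i))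
  rw [show r + i + (s - i) = r + s by omega] at h1
  refine qSpan_anti ?_ h1
  obtain ⟨t, rfl⟩ := Nat.exists_eq_add_of_le hi.2
  rw [Nat.add_sub_cancel_left]
  nlinarith [Nat.mul_le_mul hi.1 hi.1, Nat.mul_le_mul_left i h]

theorem q_mul_self_mem_qSpan {r : ℕ} (hr : r ≠ 0) :
    q r * q r ∈ qSpan (r + r) (r ^ 2 + r ^ 2 + 1) := by
  have := qTwo_sub_mem_qSpan (le_refl r)
  rw [qTwo_self hr, zero_sub] at this
  exact (Submodule.neg_mem_iff _).1 this

/-- The skew-symmetric matrix with entries `Q_{(x_i, x_j)}` for `i < j`. -/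
noncomputable def skewMatrix {N : ℕ} (x : Fin N → ℕ) :
    Matrix (Fin N) (Fin N) (MvPowerSeries ℕ ℚ) :=
  fun i j => if i < j then qTwo (x i) (x j) else if j < i then -qTwo (x j) (x i) else 0

theorem skewMatrix_submatrix {N M : ℕ} (x : Fin N → ℕ) {g : Fin M → Fin N} (hg : StrictMono g) :
    (skewMatrix x).submatrix g g = skewMatrix (x ∘ g) := by
  ext1 i j
  simp only [skewMatrix, Matrix.submatrix_apply, hg.lt_iff_lt, Function.comp_apply]

theorem mul_sub_mul_mem_qSpan {a b k l : ℕ} {f f' g g' : MvPowerSeries ℕ ℚ}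
    (hf : f - f' ∈ qSpan a (k + 1)) (hf' : f' ∈ qSpan a k) (hg : g - g' ∈ qSpan b (l + 1))
    (hg' : g' ∈ qSpan b l) : f * g - f' * g' ∈ qSpan (a + b) (k + l + 1) := by
  have h1 : g ∈ qSpan b l := by
    rw [← sub_add_cancel g g']
    exact Submodule.add_mem _ (qSpan_anti (Nat.le_succ l) hg) hg'
  have h2 := Submodule.add_mem _ (qSpan_anti (by omega) (mul_mem_qSpan hf h1))
    (qSpan_anti (k := k + l + 1) (by omega) (mul_mem_qSpan hf' hg))
  convert h2 using 1
  ring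

theorem prod_q_mem_qSpan {ι : Type*} (s : Finset ι) (x : ι → ℕ) :
    ∏ i ∈ s, q (x i) ∈ qSpan (∑ i ∈ s, x i) (∑ i ∈ s, x i ^ 2) := by
  have := qProd_mem_qSpan (s := s.val.map x) (a := ∑ i ∈ s, x i) (k := ∑ i ∈ s, x i ^ 2) rfl
    (by rw [Multiset.map_map]; exact le_rfl)
  rwa [qProd, Multiset.map_map] at this

theorem pfaffian_sub_prod_mem_qSpan (m : ℕ) (x : Fin (2 * m) → ℕ) (hx : Antitone x) :
    pfaffian m (skewMatrix x) - ∏ i, q (x i) ∈ qSpan (∑ i, x i) (∑ i, x i ^ 2 + 1) := by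
  induction m with
  | zero => simp [pfaffian]
  | succ m ih =>
    have h1 : (∏ i, q (x i)) = ∑ j : Fin (2 * m + 1), (-1) ^ (j : ℕ) * ∏ i, q (x i) := by
      rw [← Finset.sum_mul, Fin.sum_univ_eq_sum_range (fun j => (-1 : MvPowerSeries ℕ ℚ) ^ j),
        neg_one_geom_sum, if_neg (by simp), one_mul]
    rw [pfaffian, h1, ← Finset.sum_sub_distrib]
    refine Submodule.sum_mem _ fun j _ => ?_
    rw [mul_assoc, ← mul_sub]
    refine neg_one_pow_mul_mem ?_ _
    have hg : StrictMono fun k : Fin (2 * m) => (j.succAbove k).succ :=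
      fun a b hab => Fin.succ_lt_succ_iff.2 (Fin.strictMono_succAbove j hab)
    rw [skewMatrix_submatrix (N := 2 * m + 2) x hg]
    have h0 : skewMatrix (N := 2 * m + 2) x 0 j.succ = qTwo (x (0 : Fin (2 * m + 2))) (x j.succ) :=
      if_pos (Fin.succ_pos j)
    have hp := Fin.prod_univ_succ (n := 2 * m + 1) fun i => q (x i)
    have hs := Fin.sum_univ_succ (n := 2 * m + 1) fun i => x i
    have hq := Fin.sum_univ_succ (n := 2 * m + 1) fun i => x i ^ 2
    rw [Fin.prod_univ_succAbove _ j, ← mul_assoc] at hp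
    rw [Fin.sum_univ_succAbove _ j, ← add_assoc] at hs hq
    have h2 := mul_sub_mul_mem_qSpan (qTwo_sub_mem_qSpan (hx (Fin.zero_le j.succ)))
      (mul_mem_qSpan (q_mem_qSpan _) (q_mem_qSpan _))
      (ih (x ∘ fun k : Fin (2 * m) => (j.succAbove k).succ) (hx.comp_monotone hg.monotone))
      (prod_q_mem_qSpan _ _)
    rw [← h0] at h2
    simp only [Function.comp_apply] at h2
    rw [← hp, ← hs, ← hq] at h2
    exact h2

@[to_additive]
theorem prod_getD_eq_prod_map {M : Type*} [CommMonoid M] (f : ℕ → M) (hf : f 0 = 1) (l : List ℕ)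
    (N : ℕ) (hN : l.length ≤ N) : ∏ i : Fin N, f (l.getD i 0) = (l.map f).prod := by
  induction l generalizing N with
  | nil => simp [hf]
  | cons a l ih =>
    cases N with
    | zero => simp at hN
    | succ N =>
      rw [Fin.prod_univ_succ]
      simp only [Fin.val_zero, List.getD_cons_zero, Fin.val_succ, List.getD_cons_succ,
        List.map_cons, List.prod_cons]
      rw [ih N (by simpa using hN)]

variable {n : ℕ}

theorem part_antitone (μ : n.Partition) : Antitone (part μ) := by
  intro i j hij
  rw [part, part]
  by_cases hj : j < (μ.parts.sort (· ≥ ·)).length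
  · rw [List.getD_eq_getElem _ _ hj, List.getD_eq_getElem _ _ (hij.trans_lt hj)]
    rcases hij.eq_or_lt with rfl | h
    · exact le_rfl
    · exact List.pairwise_iff_getElem.1 (Multiset.pairwise_sort μ.parts (· ≥ ·)) i j _ hj h
  · rw [List.getD_eq_default _ _ (not_lt.1 hj)]
    exact Nat.zero_le _

theorem schurQ_sub_mem_qSpan (μ : n.Partition) :
    schurQ μ - qProd μ.parts ∈ qSpan n ((μ.parts.map (· ^ 2)).sum + 1) := by
  have h := pfaffian_sub_prod_mem_qSpan ((μ.parts.card + 1) / 2) (fun i => part μ i)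
    fun i j hij => part_antitone μ hij
  have hN : (μ.parts.sort (· ≥ ·)).length ≤ 2 * ((μ.parts.card + 1) / 2) := by
    rw [Multiset.length_sort]; omega
  have hs : ((μ.parts.sort (· ≥ ·) : List ℕ) : Multiset ℕ) = μ.parts := Multiset.sort_eq _ _
  have h1 := prod_getD_eq_prod_map q q_zero _ _ hN
  have h2 := sum_getD_eq_sum_map id rfl _ _ hN
  have h3 := sum_getD_eq_sum_map (· ^ 2) (by simp) _ _ hN
  rw [← Multiset.prod_coe, ← Multiset.map_coe, hs] at h1
  rw [← Multiset.sum_coe, ← Multiset.map_coe, hs] at h2 h3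
  rw [Multiset.map_id, μ.parts_sum] at h2
  have hpart : ∀ i, (μ.parts.sort (· ≥ ·)).getD i 0 = part μ i := fun _ => rfl
  simp only [id, hpart] at h1 h2 h3
  rw [h1, h2, h3] at h
  exact h

theorem sum_sq_le (s : Multiset ℕ) : (s.map (· ^ 2)).sum ≤ s.sum ^ 2 := by
  induction s using Multiset.induction_on with
  | empty => simp
  | cons a s ih =>
    rw [Multiset.map_cons, Multiset.sum_cons, Multiset.sum_cons]
    nlinarith [Nat.zero_le (a * s.sum)]

theorem qProd_filter_ne_zero (s : Multiset ℕ) : qProd (s.filter (· ≠ 0)) = qProd s := by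
  induction s using Multiset.induction_on with
  | empty => simp
  | cons a s ih =>
    by_cases ha : a = 0
    · rw [Multiset.filter_cons_of_neg (p := (· ≠ 0)) _ (by simpa using ha), ih]
      simp [qProd, ha, q_zero]
    · rw [Multiset.filter_cons_of_pos (p := (· ≠ 0)) _ ha, qProd, Multiset.map_cons,
        Multiset.prod_cons, ← qProd, ih]
      simp [qProd]

theorem sum_sq_filter_ne_zero (s : Multiset ℕ) :
    ((s.filter (· ≠ 0)).map (· ^ 2)).sum = (s.map (· ^ 2)).sum := by
  induction s using Multiset.induction_on with
  | empty => simp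
  | cons a s ih =>
    by_cases ha : a = 0
    · rw [Multiset.filter_cons_of_neg (p := (· ≠ 0)) _ (by simpa using ha), ih]
      simp [ha]
    · rw [Multiset.filter_cons_of_pos (p := (· ≠ 0)) _ ha, Multiset.map_cons, Multiset.sum_cons, ih]
      simp

theorem qSpan_le_span_schurP (n k : ℕ) :
    qSpan n k ≤ Submodule.span ℚ (schurP '' (Nat.Partition.distincts n : Set n.Partition)) := by
  obtain ⟨t, ht⟩ : ∃ t, n ^ 2 + 1 ≤ k + t := ⟨n ^ 2 + 1, by omega⟩
  induction t generalizing k with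
  | zero =>
    refine Submodule.span_le.2 ?_
    rintro _ ⟨s, rfl, hk, rfl⟩
    have := sum_sq_le s
    omega
  | succ t ih =>
    refine Submodule.span_le.2 ?_
    rintro _ ⟨s, hs, hk, rfl⟩
    have ih' := ih (k + 1) (by omega)
    let μ := Nat.Partition.ofSums n s hs
    have hμ : μ.parts = s.filter (· ≠ 0) := rfl
    rw [← qProd_filter_ne_zero, ← hμ]
    rw [← sum_sq_filter_ne_zero, ← hμ] at hk
    by_cases hd : μ.parts.Nodup
    · have h1 := ih' (qSpan_anti (by omega) (schurQ_sub_mem_qSpan μ))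
      have h2 : schurQ μ = (2 : ℚ) ^ μ.parts.card • schurP μ := by
        rw [schurP, smul_smul, mul_inv_cancel₀ (by positivity), one_smul]
      have h3 : schurQ μ ∈
          Submodule.span ℚ (schurP '' (Nat.Partition.distincts n : Set n.Partition)) := by
        rw [h2]
        refine Submodule.smul_mem _ _ (Submodule.subset_span ⟨μ, ?_, rfl⟩)
        simpa [Nat.Partition.distincts] using hd
      simpa using Submodule.sub_mem _ h3 h1
    · rw [Multiset.nodup_iff_le] at hd
      push Not at hd
      obtain ⟨r, hr⟩ := hd
      obtain ⟨u, hu⟩ := Multiset.le_iff_exists_add.1 hr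
      have hr0 : r ≠ 0 := (μ.parts_pos (i := r) (by simp [hu])).ne'
      have h1 := mul_mem_qSpan (q_mul_self_mem_qSpan hr0)
        (qProd_mem_qSpan (s := u) (k := (u.map (· ^ 2)).sum) rfl le_rfl)
      have h2 : qProd μ.parts = q r * q r * qProd u := by simp [qProd, hu, mul_assoc]
      have h3 : r + r + u.sum = n := by
        rw [← μ.parts_sum, hu]; simp [add_assoc]
      rw [← h2, h3] at h1
      refine ih' (qSpan_anti ?_ h1)
      rw [hu] at hk
      simp only [Multiset.cons_add, zero_add, Multiset.map_cons, Multiset.sum_cons] at hk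
      omega

theorem coeff_qSeries_pow_mem_qSpan (N n : ℕ) : coeff n (qSeries ^ N) ∈ qSpan n 0 := by
  induction N generalizing n with
  | zero =>
    rw [pow_zero, coeff_one]
    split_ifs with h
    · exact qProd_mem_qSpan (s := 0) (by simp [h]) (by simp)
    · exact Submodule.zero_mem _
  | succ N ih =>
    rw [pow_succ, coeff_mul]
    refine Submodule.sum_mem _ fun x hx => ?_
    rw [Finset.HasAntidiagonal.mem_antidiagonal] at hx
    rw [← hx, qSeries, coeff_mk]
    exact qSpan_anti (Nat.zero_le _) (mul_mem_qSpan (ih x.1) (q_mem_qSpan x.2))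

theorem shiftedParkingSymm_mem_span_schurP (n : ℕ) : shiftedParkingSymm n ∈
    Submodule.span ℚ (schurP '' (Nat.Partition.distincts n : Set n.Partition)) := by
  rw [shiftedParkingSymm_eq_coeff]
  exact Submodule.smul_mem _ _ (qSpan_le_span_schurP n 0 (coeff_qSeries_pow_mem_qSpan _ n))

end Span

/-! ### Polynomials in the functions `P_k` with `k` odd -/

section Odd

theorem indiscrete_sort {n : ℕ} (hn : n ≠ 0) :
    (Nat.Partition.indiscrete n).parts.sort (· ≥ ·) = [n] := by
  rw [Nat.Partition.indiscrete_parts hn, Multiset.sort_singleton]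

theorem schurPRow_eq {n : ℕ} (hn : n ≠ 0) : schurPRow n = (2 : ℚ)⁻¹ • q n := by
  have h : ∀ c, c = 1 → ((2 : ℚ) ^ c)⁻¹ •
      pfaffian ((c + 1) / 2) (qMatrix (Nat.Partition.indiscrete n) ((c + 1) / 2)) =
      (2 : ℚ)⁻¹ • q n := by
    rintro _ rfl
    change ((2 : ℚ) ^ 1)⁻¹ • pfaffian 1 (qMatrix (Nat.Partition.indiscrete n) 1) = _
    simp [pfaffian, qMatrix, part, indiscrete_sort hn, qTwo, q_zero]
  exact h _ (by rw [Nat.Partition.indiscrete_parts hn, Multiset.card_singleton])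

theorem q_mem_adjoin (n : ℕ) :
    q n ∈ Algebra.adjoin ℚ (Set.range fun k : {k : ℕ // Odd k} => schurPRow k) := by
  induction n using Nat.strong_induction_on with
  | _ n ih =>
    rcases Nat.even_or_odd' n with ⟨r, rfl | rfl⟩
    · rcases Nat.eq_zero_or_pos r with rfl | hr
      · rw [mul_zero, q_zero]
        exact one_mem _
      · have h := qTwo_self hr.ne'
        rw [qTwo, ← Finset.insert_erase (Finset.right_mem_Icc.2 hr),
          Finset.sum_insert (Finset.notMem_erase _ _), Nat.sub_self, q_zero, mul_one,
          ← two_mul r] at h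
        set T := ∑ i ∈ (Finset.Icc 1 r).erase r,
          (-1 : MvPowerSeries ℕ ℚ) ^ i * (q (r + i) * q (r - i)) with hT
        have h1 : ((-1) ^ r * (-1) ^ r : MvPowerSeries ℕ ℚ) = 1 := by rw [← mul_pow]; simp
        have h2 : (2 : ℚ) • q (2 * r) = -(-1) ^ r * (q r * q r + 2 * T) := by
          rw [two_smul]
          linear_combination (-1) ^ r * h - 2 * q (2 * r) * h1
        have h3 : q (2 * r) = (2 : ℚ)⁻¹ • (-(-1) ^ r * (q r * q r + 2 * T)) := by
          rw [← h2, smul_smul, inv_mul_cancel₀ two_ne_zero, one_smul]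
        have hneg : ∀ i : ℕ, (-1 : MvPowerSeries ℕ ℚ) ^ i ∈
            Algebra.adjoin ℚ (Set.range fun k : {k : ℕ // Odd k} => schurPRow k) :=
          fun i => pow_mem (neg_mem (one_mem _)) i
        rw [h3]
        refine Subalgebra.smul_mem _ (mul_mem (neg_mem (hneg r)) (add_mem
          (mul_mem (ih r (by omega)) (ih r (by omega))) ?_)) _
        rw [two_mul]
        refine (fun hx => add_mem hx hx) (sum_mem fun i hi => ?_)
        rw [Finset.mem_erase, Finset.mem_Icc] at hi
        exact mul_mem (hneg i) (mul_mem (ih _ (by omega)) (ih _ (by omega)))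
    · have h : q (2 * r + 1) = (2 : ℚ) • schurPRow (2 * r + 1) := by
        rw [schurPRow_eq (by omega), smul_smul, mul_inv_cancel₀ two_ne_zero, one_smul]
      rw [h]
      exact Subalgebra.smul_mem _ (Algebra.subset_adjoin
        (Set.mem_range_self (⟨2 * r + 1, odd_two_mul_add_one r⟩ : {k : ℕ // Odd k}))) _

theorem coeff_qSeries_pow_mem_adjoin (N n : ℕ) : coeff n (qSeries ^ N) ∈
    Algebra.adjoin ℚ (Set.range fun k : {k : ℕ // Odd k} => schurPRow k) := by
  induction N generalizing n with
  | zero =>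
    rw [pow_zero, coeff_one]
    split_ifs
    · exact one_mem _
    · exact zero_mem _
  | succ N ih =>
    rw [pow_succ, coeff_mul]
    refine sum_mem fun x _ => mul_mem (ih x.1) ?_
    rw [qSeries, coeff_mk]
    exact q_mem_adjoin x.2

theorem exists_aeval_schurPRow_eq (n : ℕ) : ∃ F : MvPolynomial {k : ℕ // Odd k} ℚ,
    MvPolynomial.aeval (fun k : {k : ℕ // Odd k} => schurPRow k) F = shiftedParkingSymm n := by
  have h : shiftedParkingSymm n ∈
      Algebra.adjoin ℚ (Set.range fun k : {k : ℕ // Odd k} => schurPRow k) := by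
    rw [shiftedParkingSymm_eq_coeff]
    exact Subalgebra.smul_mem _ (coeff_qSeries_pow_mem_adjoin _ n) _
  rwa [Algebra.adjoin_range_eq_range_aeval] at h

end Odd

/-! ### Specialization at `x = (t, …, t, 0, 0, …)` -/

section Specialization

theorem hasSubst_ones (N : ℕ) :
    MvPowerSeries.HasSubst fun i => (C (ones N i) * X : ℚ⟦X⟧) where
  const_coeff i := by
    have : constantCoeff (C (ones N i) * X : ℚ⟦X⟧) = 0 := by simp
    exact this ▸ IsNilpotent.zero
  coeff_zero d := by
    refine (Set.finite_Iio N).subset fun i hi => ?_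
    by_contra h
    refine hi ?_
    have : ones N i = 0 := if_neg h
    simp [this]

/-- The specialization `x_i ↦ t` for `i < N` and `x_i ↦ 0` for `i ≥ N`. -/
noncomputable def evalOnes (N : ℕ) : MvPowerSeries ℕ ℚ →ₐ[ℚ] ℚ⟦X⟧ :=
  MvPowerSeries.substAlgHom (hasSubst_ones N)

theorem coeff_evalOnes (N m : ℕ) (f : MvPowerSeries ℕ ℚ) :
    coeff m (evalOnes N f) = ∑ᶠ d : ℕ →₀ ℕ, MvPowerSeries.coeff d f *
      if d.degree = m then d.prod fun i k => ones N i ^ k else 0 := by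
  rw [evalOnes, MvPowerSeries.substAlgHom_apply, coeff, MvPowerSeries.coeff_subst (hasSubst_ones N)]
  refine finsum_congr fun d => ?_
  have h : (d.prod fun i k => (C (ones N i) * X : ℚ⟦X⟧) ^ k) =
      C (d.prod fun i k => ones N i ^ k) * X ^ d.degree := by
    simp only [mul_pow, Finsupp.prod, Finset.prod_mul_distrib, Finset.prod_pow_eq_pow_sum,
      map_prod, map_pow, Finsupp.degree_apply]
  have h2 : coeff m (C (d.prod fun i k => ones N i ^ k) * X ^ d.degree) =
      if d.degree = m then d.prod fun i k => ones N i ^ k else 0 := by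
    rw [coeff_C_mul, coeff_X_pow, mul_ite, mul_one, mul_zero]
    simp only [eq_comm]
  rw [← h2, ← h, smul_eq_mul]
  rfl

theorem specialize_eq_coeff_evalOnes {N n : ℕ} {f : MvPowerSeries ℕ ℚ}
    (hf : ∀ d : ℕ →₀ ℕ, d.degree ≠ n → MvPowerSeries.coeff d f = 0) :
    specialize (ones N) f = coeff n (evalOnes N f) := by
  rw [specialize, coeff_evalOnes]
  refine finsum_congr fun d => ?_
  split_ifs with h
  · rfl
  · rw [hf d h, zero_mul, zero_mul]

theorem evalOnes_psum (N : ℕ) {k : ℕ} (hk : k ≠ 0) : evalOnes N (psum k) = (N : ℚ) • X ^ k := by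
  classical
  ext m
  rw [coeff_evalOnes, coeff_smul, coeff_X_pow, smul_eq_mul, mul_ite, mul_one, mul_zero]
  have hinj : Function.Injective fun i : ℕ => (Finsupp.single i k : ℕ →₀ ℕ) :=
    fun i j h => (Finsupp.single_left_inj hk).1 h
  rw [finsum_eq_sum_of_support_subset (s := (Finset.range N).image fun i => Finsupp.single i k),
    Finset.sum_image hinj.injOn]
  · rw [Finset.sum_congr rfl (g := fun _ => if m = k then (1 : ℚ) else 0)]
    · split_ifs <;> simp
    · intro i hi
      have h1 : MvPowerSeries.coeff (Finsupp.single i k) (psum k) = 1 := if_pos ⟨i, rfl⟩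
      have h2 : ones N i = 1 := if_pos (Finset.mem_range.1 hi)
      rw [h1, Finsupp.degree_single, Finsupp.prod_single_index (by simp), h2, one_pow, one_mul]
      simp only [eq_comm]
  · intro d hd
    rw [Function.mem_support] at hd
    have h1 : ∃ i : ℕ, d = Finsupp.single i k := by
      by_contra h
      have h1 : MvPowerSeries.coeff d (psum k) = 0 := if_neg h
      exact hd (by rw [h1, zero_mul])
    obtain ⟨i, rfl⟩ := h1
    rw [Finset.mem_coe, Finset.mem_image]
    refine ⟨i, ?_, rfl⟩
    rw [Finset.mem_range]
    by_contra h
    have h2 : ones N i = 0 := if_neg h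
    refine hd ?_
    rw [Finsupp.prod_single_index (by simp), h2, zero_pow hk, ite_self, mul_zero]

theorem map_evalOnes_qSeries (N : ℕ) : PowerSeries.map (evalOnes N : MvPowerSeries ℕ ℚ →+* ℚ⟦X⟧)
    qSeries = rescale X (PowerSeries.map C (mobius ^ N)) := by
  have h1 := hasLogDeriv_qSeries.map (evalOnes N : MvPowerSeries ℕ ℚ →+* ℚ⟦X⟧)
  have h2 := ((hasLogDeriv_mobius.pow N).map (C (R := ℚ))).rescale X
  refine h1.unique ?_
  convert h2 using 1
  ext1 k
  rw [coeff_rescale, coeff_map, coeff_map, ← nsmul_eq_mul, map_nsmul, oddPsumSeries, coeff_mk,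
    oddSeries, coeff_mk]
  split_ifs with hk
  · have hk0 : k ≠ 0 := by rintro rfl; simp at hk
    rw [map_mul, RingHom.coe_coe, evalOnes_psum N hk0, smul_eq_C_mul]
    simp only [nsmul_eq_mul, map_mul, map_natCast, map_ofNat]
    ring
  · simp

theorem evalOnes_coeff_qSeries_pow (N M n : ℕ) : evalOnes N (coeff n (qSeries ^ M)) =
    coeff n (mobius ^ (N * M)) • X ^ n := by
  have h := congrArg (coeff n) (congrArg (· ^ M) (map_evalOnes_qSeries N))
  simp only [← map_pow, coeff_map, coeff_rescale, ← pow_mul] at h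
  rw [smul_eq_C_mul, mul_comm (C _)]
  exact h

theorem evalOnes_q (N n : ℕ) : evalOnes N (q n) = coeff n (mobius ^ N) • X ^ n := by
  have := evalOnes_coeff_qSeries_pow N 1 n
  rwa [pow_one, mul_one, qSeries, coeff_mk] at this

theorem specialize_schurPRow {n : ℕ} (hn : n ≠ 0) (N : ℕ) :
    specialize (ones N) (schurPRow n) = 2⁻¹ * coeff n (mobius ^ N) := by
  rw [specialize_eq_coeff_evalOnes (n := n), schurPRow_eq hn, map_smul, evalOnes_q]
  · simp [coeff_X_pow]
  · intro d hd
    rw [schurPRow_eq hn, MvPowerSeries.coeff_smul, coeff_q, if_neg hd, mul_zero]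

theorem evalOnes_one_shiftedParkingSymm (n : ℕ) :
    evalOnes 1 (shiftedParkingSymm n) = (Nat.largeSchroder n : ℚ) • X ^ n := by
  rw [shiftedParkingSymm_eq_coeff, map_smul, evalOnes_coeff_qSeries_pow, one_mul,
    coeff_mobius_pow_succ, smul_smul, inv_mul_cancel_left₀ (by positivity)]

theorem coeff_mobius (n : ℕ) : coeff n mobius = if n = 0 then 1 else 2 := by
  have h : ∀ m, coeff (m + 1) mobius - coeff m mobius = if m = 0 then 1 else 0 := by
    intro m
    rw [← coeff_one_sub_X_mul, one_sub_X_mul_mobius, map_add, coeff_X, coeff_one]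
    simp
  induction n with
  | zero => simpa using constantCoeff_mobius
  | succ n ih =>
    have h1 := h n
    rw [ih] at h1
    rw [if_neg (Nat.succ_ne_zero n)]
    split_ifs at h1 <;> linarith

theorem evalOnes_one_schurPRow {n : ℕ} (hn : n ≠ 0) : evalOnes 1 (schurPRow n) = X ^ n := by
  rw [schurPRow_eq hn, map_smul, evalOnes_q, pow_one, coeff_mobius, if_neg hn, smul_smul,
    inv_mul_cancel₀ two_ne_zero, one_smul]

theorem sum_neg_one_pow_mul_coeff_mobius {s : ℕ} (hs : 1 ≤ s) :
    ∑ i ∈ Finset.Icc 1 s, (-1) ^ i * coeff (s - i) mobius = -1 := by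
  rw [← Finset.Ico_add_one_right_eq_Icc, Finset.sum_Ico_eq_sum_range, Nat.add_sub_cancel]
  induction s, hs using Nat.le_induction with
  | base => simp [constantCoeff_mobius]
  | succ s hs ih =>
    rw [Finset.sum_range_succ']
    have h : ∀ i ∈ Finset.range s, (-1 : ℚ) ^ (1 + (i + 1)) * coeff (s + 1 - (1 + (i + 1))) mobius =
        - ((-1) ^ (1 + i) * coeff (s - (1 + i)) mobius) := by
      intro i _
      rw [show s + 1 - (1 + (i + 1)) = s - (1 + i) by omega]
      ring
    rw [Finset.sum_congr rfl h, Finset.sum_neg_distrib, ih]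
    simp only [add_zero, Nat.add_sub_cancel, coeff_mobius]
    rw [if_neg (by omega)]
    norm_num

theorem evalOnes_one_qTwo {r s : ℕ} (hs : 1 ≤ s) (hr : 1 ≤ r) : evalOnes 1 (qTwo r s) = 0 := by
  have h : ∀ i ∈ Finset.Icc 1 s, evalOnes 1 ((-1) ^ i * (q (r + i) * q (s - i))) =
      (2 * ((-1) ^ i * coeff (s - i) mobius)) • X ^ (r + s) := by
    intro i hi
    rw [Finset.mem_Icc] at hi
    rw [map_mul, map_mul, evalOnes_q, evalOnes_q, pow_one, coeff_mobius (r + i),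
      if_neg (by omega), smul_mul_smul_comm, ← pow_add, show r + i + (s - i) = r + s by omega,
      map_pow, map_neg, map_one, smul_eq_C_mul, smul_eq_C_mul]
    simp only [map_mul, map_pow, map_neg, map_one]
    ring
  rw [qTwo, map_add, map_mul, map_mul, map_sum, Finset.sum_congr rfl h, ← Finset.sum_smul,
    ← Finset.mul_sum, sum_neg_one_pow_mul_coeff_mobius hs, evalOnes_q, evalOnes_q, pow_one,
    coeff_mobius, coeff_mobius, if_neg (by omega), if_neg (by omega), smul_mul_smul_comm, ← pow_add,
    map_ofNat, smul_eq_C_mul, smul_eq_C_mul]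
  simp only [map_mul, map_neg, map_one, map_ofNat]
  ring

theorem map_pfaffian {R S : Type*} [CommRing R] [CommRing S] (φ : R →+* S) (m : ℕ)
    (A : Matrix (Fin (2 * m)) (Fin (2 * m)) R) : φ (pfaffian m A) = pfaffian m (A.map φ) := by
  induction m with
  | zero => simp [pfaffian]
  | succ m ih =>
    simp only [pfaffian, map_sum, map_mul, map_pow, map_neg, map_one, ih]
    rfl

theorem pfaffian_eq_zero {R : Type*} [CommRing R] {m l : ℕ} (hl : 2 ≤ l) (hm : l ≤ 2 * m)
    (hml : 2 * m ≤ l + 1) (A : Matrix (Fin (2 * m)) (Fin (2 * m)) R)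
    (hA : ∀ i j : Fin (2 * m), (i : ℕ) < l → (j : ℕ) < l → A i j = 0) : pfaffian m A = 0 := by
  obtain _ | m := m
  · omega
  rw [pfaffian]
  refine Finset.sum_eq_zero fun j _ => ?_
  by_cases hj : (j : ℕ) + 1 < l
  · rw [hA (0 : Fin (2 * m + 2)) j.succ (by simp; omega) (by simpa using hj), mul_zero, zero_mul]
  · obtain rfl : j = Fin.last (2 * m) := by
      ext
      have := j.2
      simp only [Fin.val_last]
      omega
    obtain _ | m := m
    · simp at hj; omega
    rw [pfaffian, Finset.sum_eq_zero, mul_zero]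
    intro k _
    rw [Matrix.submatrix_apply, hA _ _ ?_ ?_, mul_zero, zero_mul]
    · simp only [Fin.succAbove_last, Fin.val_succ, Fin.val_castSucc]
      simp at hj ⊢
      omega
    · simp only [Fin.succAbove_last, Fin.val_succ, Fin.val_castSucc]
      simp at hj ⊢
      omega

variable {n : ℕ}

theorem one_le_part (μ : n.Partition) {i : ℕ} (hi : i < μ.parts.card) : 1 ≤ part μ i := by
  have hi' : i < (μ.parts.sort (· ≥ ·)).length := by rwa [Multiset.length_sort]
  rw [part, List.getD_eq_getElem _ _ hi']
  exact μ.parts_pos ((Multiset.mem_sort (· ≥ ·)).1 (List.getElem_mem hi'))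

theorem evalOnes_one_schurP_of_two_le (μ : n.Partition) (hμ : 2 ≤ μ.parts.card) :
    evalOnes 1 (schurP μ) = 0 := by
  have h := map_pfaffian (evalOnes 1 : MvPowerSeries ℕ ℚ →+* ℚ⟦X⟧) ((μ.parts.card + 1) / 2)
    (qMatrix μ ((μ.parts.card + 1) / 2))
  have h0 : pfaffian ((μ.parts.card + 1) / 2) ((qMatrix μ ((μ.parts.card + 1) / 2)).map
      (evalOnes 1 : MvPowerSeries ℕ ℚ →+* ℚ⟦X⟧)) = 0 := by
    refine pfaffian_eq_zero hμ (by omega) (by omega) _ fun i j hi hj => ?_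
    rw [Matrix.map_apply, qMatrix, RingHom.coe_coe]
    split_ifs
    · exact evalOnes_one_qTwo (one_le_part μ hj) (one_le_part μ hi)
    · rw [map_neg, evalOnes_one_qTwo (one_le_part μ hi) (one_le_part μ hj), neg_zero]
    · exact map_zero _
  rw [h0, RingHom.coe_coe] at h
  rw [schurP, map_smul, schurQ, h, smul_zero]

theorem two_le_card_parts (hn : n ≠ 0) {μ : n.Partition} (hμ : μ ≠ Nat.Partition.indiscrete n) :
    2 ≤ μ.parts.card := by
  by_contra! h
  interval_cases hc : μ.parts.card
  · rw [Multiset.card_eq_zero] at hc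
    have := μ.parts_sum
    rw [hc] at this
    exact hn (by simpa using this.symm)
  · obtain ⟨a, ha⟩ := Multiset.card_eq_one.1 hc
    have := μ.parts_sum
    rw [ha, Multiset.sum_singleton] at this
    exact hμ (Nat.Partition.ext (by rw [ha, this, Nat.Partition.indiscrete_parts hn]))

theorem coeffSum_eq_aeval_one {σ : Type*} (F : MvPolynomial σ ℚ) :
    coeffSum F = MvPolynomial.aeval (fun _ => (1 : ℚ)) F := by
  rw [MvPolynomial.aeval_def, MvPolynomial.eval₂_eq]
  simp [coeffSum]

theorem coeffSum_eq_of_aeval_X_pow {σ : Type*} {w : σ → ℕ} {F : MvPolynomial σ ℚ} {c : ℚ} {n : ℕ}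
    (hF : MvPolynomial.aeval (fun i => (X : ℚ⟦X⟧) ^ w i) F = c • X ^ n) : coeffSum F = c := by
  have h1 : (MvPolynomial.aeval (fun i => (Polynomial.X : Polynomial ℚ) ^ w i) F) =
      c • Polynomial.X ^ n := by
    apply Polynomial.coe_injective
    have h : (Polynomial.coeToPowerSeries.algHom ℚ).comp
        (MvPolynomial.aeval fun i => (Polynomial.X : Polynomial ℚ) ^ w i) =
        MvPolynomial.aeval fun i => (X : ℚ⟦X⟧) ^ w i :=
      MvPolynomial.algHom_ext fun i => by simp [Polynomial.coeToPowerSeries.algHom_apply]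
    rw [← h, AlgHom.comp_apply, Polynomial.coeToPowerSeries.algHom_apply] at hF
    simpa [Polynomial.coe_smul] using hF
  have h2 : (Polynomial.aeval (1 : ℚ)).comp
      (MvPolynomial.aeval fun i => (Polynomial.X : Polynomial ℚ) ^ w i) =
      MvPolynomial.aeval fun _ => (1 : ℚ) :=
    MvPolynomial.algHom_ext fun i => by simp
  rw [coeffSum_eq_aeval_one, ← h2, AlgHom.comp_apply, h1]
  simp

end Specialization

/-! ### The three numbers -/

section LargeSchroder

variable {n : ℕ}

theorem two_div_mul_specialize_schurPRow (hn : n ≠ 0) :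
    2 / ((n : ℚ) + 1) * specialize (ones (n + 1)) (schurPRow n) = Nat.largeSchroder n := by
  rw [specialize_schurPRow hn, coeff_mobius_pow_succ]
  have : (n : ℚ) + 1 ≠ 0 := by positivity
  field_simp

theorem exists_shiftedParkingSymm_eq_sum_schurP (n : ℕ) : ∃ b : n.Partition → ℚ,
    shiftedParkingSymm n = ∑ μ ∈ Nat.Partition.distincts n, b μ • schurP μ := by
  obtain ⟨b, hb⟩ := (Submodule.mem_span_image_finset_iff_exists_fun' ℚ).1
    (shiftedParkingSymm_mem_span_schurP n)
  exact ⟨b, hb.symm⟩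

theorem coeff_indiscrete_eq_largeSchroder (hn : n ≠ 0) {b : n.Partition → ℚ}
    (hb : shiftedParkingSymm n = ∑ μ ∈ Nat.Partition.distincts n, b μ • schurP μ) :
    b (Nat.Partition.indiscrete n) = Nat.largeSchroder n := by
  have h := congrArg (evalOnes 1) hb
  have hmem : Nat.Partition.indiscrete n ∈ Nat.Partition.distincts n := by
    simp [Nat.Partition.distincts, Nat.Partition.indiscrete_parts hn]
  rw [evalOnes_one_shiftedParkingSymm, map_sum, Finset.sum_eq_single_of_mem _ hmem
    (fun μ _ hμ => by
      rw [map_smul, evalOnes_one_schurP_of_two_le μ (two_le_card_parts hn hμ), smul_zero]),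
    map_smul, ← schurPRow, evalOnes_one_schurPRow hn] at h
  have := congrArg (PowerSeries.coeff n) h
  simpa using this.symm

theorem coeffSum_eq_largeSchroder {F : MvPolynomial {k : ℕ // Odd k} ℚ}
    (hF : MvPolynomial.aeval (fun k : {k : ℕ // Odd k} => schurPRow k) F = shiftedParkingSymm n) :
    coeffSum F = Nat.largeSchroder n := by
  refine coeffSum_eq_of_aeval_X_pow (w := fun k : {k : ℕ // Odd k} => (k : ℕ)) (n := n) ?_
  rw [← evalOnes_one_shiftedParkingSymm, ← hF, ← AlgHom.comp_apply]
  refine DFunLike.congr_fun (MvPolynomial.algHom_ext fun k => ?_) F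
  simp [evalOnes_one_schurPRow k.2.pos.ne']

end LargeSchroder

end ShiftedParking

theorem corollary2 (n : ℕ) (hn : 1 ≤ n) :
    -- first number: `(2 / (n + 1)) P_n(1^{n+1})`
    (2 / ((n : ℚ) + 1) *
        ShiftedParking.specialize (ShiftedParking.ones (n + 1)) (ShiftedParking.schurPRow n)
      = (Nat.largeSchroder n : ℚ)) ∧
    -- second number: the coefficient of `P_n` in the expansion of `SH_n` in the `P_μ`
    ((∃ b : n.Partition → ℚ,
        ShiftedParking.shiftedParkingSymm n
          = ∑ μ ∈ Nat.Partition.distincts n, b μ • ShiftedParking.schurP μ) ∧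
      ∀ b : n.Partition → ℚ,
        ShiftedParking.shiftedParkingSymm n
          = ∑ μ ∈ Nat.Partition.distincts n, b μ • ShiftedParking.schurP μ →
        b (Nat.Partition.indiscrete n) = (Nat.largeSchroder n : ℚ)) ∧
    -- third number: the sum of the coefficients of `SH_n` as a polynomial in `P_1, P_3, P_5, …`
    ((∃ F : MvPolynomial {k : ℕ // Odd k} ℚ,
        MvPolynomial.aeval (fun k : {k : ℕ // Odd k} => ShiftedParking.schurPRow k) F
          = ShiftedParking.shiftedParkingSymm n) ∧
      ∀ F : MvPolynomial {k : ℕ // Odd k} ℚ,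
        MvPolynomial.aeval (fun k : {k : ℕ // Odd k} => ShiftedParking.schurPRow k) F
          = ShiftedParking.shiftedParkingSymm n →
        ShiftedParking.coeffSum F = (Nat.largeSchroder n : ℚ)) := by
  have hn0 : n ≠ 0 := Nat.one_le_iff_ne_zero.1 hn
  exact ⟨ShiftedParking.two_div_mul_specialize_schurPRow hn0,
    ⟨ShiftedParking.exists_shiftedParkingSymm_eq_sum_schurP n,
      fun _ hb => ShiftedParking.coeff_indiscrete_eq_largeSchroder hn0 hb⟩,
    ShiftedParking.exists_aeval_schurPRow_eq n,
    fun _ hF => ShiftedParking.coeffSum_eq_largeSchroder hF⟩
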